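/- **Setting.** Let $s\in(0,1)$, $n\in\mathbb N$ with $n>2s$, and let $\Omega\subset\mathbb R^n$ be a bounded open set. Let $K:\mathbb R^n\setminus\{0\}\to(0,+\infty)$ be such that $mK\in L^1(\mathbb R^n)$, where $m(x)=\min\{|x|^2,1\}$, and such that there is $\theta>0$ with $K(x)\ge\theta|x|^{-(n+2s)}$ for all $x\ne0$. Let $X$ be the space of (classes of a.e. equal) Lebesgue measurable functions $g:\mathbb R^n\to\mathbb R$ such that $g|_\Omega\in L^2(\Omega)$ and $(x,y)\mapsto(g(x)-g(y))\sqrt{K(x-y)}$ belongs to $L^2\big((\mathbb R^n\times\mathbb R^n)\setminus((\mathbb R^n\setminus\Omega)\times(\mathbb R^n\setminus\Omega)),dx\,dy\big)$. Let $X_0=\{g\in X: g=0 \text{ a.e. in }\mathbb R^n\setminus\Omega\}$, with the norm $$\|g\|_{X_0}=\Big(\int_{\mathbb R^n\times\mathbb R^n}|g(x)-g(y)|^2K(x-y)\,dx\,dy\Big)^{1/2}.$$ Let $f:\overline\Omega\times\mathbb R\to\mathbb R$, and put $F(x,t)=\int_0^tf(x,\tau)\,d\tau$ and $\mathcal F(x,t)=\frac12tf(x,t)-F(x,t)$.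 Assume: 1. $f$ is continuous on $\overline\Omega\times\mathbb R$; 2. there are $a_1,a_2>0$ and $q\in(2,2n/(n-2s))$ with $|f(x,t)|\le a_1+a_2|t|^{q-1}$ for all $x\in\Omega$, $t\in\mathbb R$; 3. $f(x,-t)=-f(x,t)$ for all $x\in\Omega$, $t\in\mathbb R$; 4. $F(x,t)/|t|^2\to+\infty$ as $|t|\to+\infty$, uniformly in $x\in\overline\Omega$; 5. there is $\gamma\ge1$ such that $\mathcal F(x,t')\le\gamma\,\mathcal F(x,t)$ for all $x\in\Omega$ and all $t,t'\in\mathbb R$ with $0<t'\le t$. For $\lambda\in\mathbb R$ define $\mathcal J_{K,\lambda}:X_0\to\mathbb R$ by $$\mathcal J_{K,\lambda}(u)=\frac12\int_{\mathbb R^n\times\mathbb R^n}|u(x)-u(y)|^2K(x-y)\,dx\,dy-\frac\lambda2\int_\Omega|u(x)|^2\,dx-\int_\Omega F(x,u(x))\,dx.$$ **Proposition.** For every $\lambda\in\mathbb R$, the functional $\mathcal J_{K,\lambda}$ is Fréchet differentiable on $X_0$ and satisfies the Cerami condition at every level $c\in\mathbb R$. That is, every sequence $(u_j)$ in $X_0$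 with $$\mathcal J_{K,\lambda}(u_j)\to c\quad\text{and}\quad(1+\|u_j\|_{X_0})\,\sup\big\{|\langle\mathcal J_{K,\lambda}'(u_j),\varphi\rangle|:\varphi\in X_0,\ \|\varphi\|_{X_0}=1\big\}\to0$$ has a subsequence that converges strongly in $X_0$. (The supremum of the empty set is taken to be $0$.) -/

import Mathlib

open MeasureTheory Filter Topology

/-- Standing assumptions on the fractional order `s`, the bounded open set `Ω ⊆ ℝⁿ` and the kernel
`K : ℝⁿ \ {0} → (0, +∞)`. The kernel is represented by a total function whose value at the origin
is irrelevant. -/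
structure NonlocalSetting {n : ℕ} (s : ℝ) (Ω : Set (EuclideanSpace ℝ (Fin n)))
    (K : EuclideanSpace ℝ (Fin n) → ℝ) : Prop where
  s_pos : 0 < s
  s_lt_one : s < 1
  two_s_lt : 2 * s < n
  isOpen : IsOpen Ω
  isBounded : Bornology.IsBounded Ω
  kernel_pos : ∀ x, x ≠ 0 → 0 < K x
  kernel_integrable : Integrable (fun x => min (‖x‖ ^ 2) 1 * K x) volume
  kernel_lower : ∃ θ : ℝ, 0 < θ ∧ ∀ x, x ≠ 0 → θ * ‖x‖ ^ (-((n : ℝ) + 2 * s)) ≤ K x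

namespace NonlocalSetting

variable {n : ℕ} {s : ℝ} {Ω : Set (EuclideanSpace ℝ (Fin n))} {K : EuclideanSpace ℝ (Fin n) → ℝ}

/-- Membership in `X`: `g` restricted to `Ω` is in `L²(Ω)` and
`(x, y) ↦ (g x - g y) √(K (x - y))` is in `L²((ℝⁿ × ℝⁿ) \ (Ωᶜ × Ωᶜ))`. -/
def MemX (Ω : Set (EuclideanSpace ℝ (Fin n))) (K : EuclideanSpace ℝ (Fin n) → ℝ)
    (g : EuclideanSpace ℝ (Fin n) → ℝ) : Prop :=
  MemLp g 2 (volume.restrict Ω) ∧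
    MemLp (fun p : EuclideanSpace ℝ (Fin n) × EuclideanSpace ℝ (Fin n) =>
      (g p.1 - g p.2) * √(K (p.1 - p.2))) 2 (volume.restrict (Ωᶜ ×ˢ Ωᶜ)ᶜ)

theorem ae_fst_snd {P : EuclideanSpace ℝ (Fin n) → Prop} (h : ∀ᵐ x, P x) :
    ∀ᵐ p : EuclideanSpace ℝ (Fin n) × EuclideanSpace ℝ (Fin n), P p.1 ∧ P p.2 :=
  (Measure.quasiMeasurePreserving_fst.ae h).and (Measure.quasiMeasurePreserving_snd.ae h)

/-- The space `X₀` of (classes of a.e. equal) Lebesgue measurable functions that belong to `X` and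
vanish a.e. outside `Ω`, as a linear subspace. -/
noncomputable def X0Submodule (Ω : Set (EuclideanSpace ℝ (Fin n)))
    (K : EuclideanSpace ℝ (Fin n) → ℝ) :
    Submodule ℝ (EuclideanSpace ℝ (Fin n) →ₘ[volume] ℝ) where
  carrier := {g | MemX Ω K g ∧ ∀ᵐ x, x ∈ Ωᶜ → g x = 0}
  add_mem' := by
    rintro u v ⟨⟨hu1, hu2⟩, hu3⟩ ⟨⟨hv1, hv2⟩, hv3⟩
    have h := AEEqFun.coeFn_add u v
    refine ⟨⟨(hu1.add hv1).ae_eq (ae_restrict_of_ae h.symm), (hu2.add hv2).ae_eq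
      (ae_restrict_of_ae ?_)⟩, ?_⟩
    · filter_upwards [ae_fst_snd h] with p hp
      simp only [Pi.add_apply] at hp ⊢
      rw [hp.1, hp.2]; ring
    · filter_upwards [h, hu3, hv3] with x hx h1 h2 hxΩ
      rw [hx, Pi.add_apply, h1 hxΩ, h2 hxΩ, add_zero]
  zero_mem' := by
    have h : ∀ᵐ x, (0 : EuclideanSpace ℝ (Fin n) →ₘ[volume] ℝ) x = 0 := AEEqFun.coeFn_zero
    refine ⟨⟨(MemLp.zero' (ε := ℝ)).ae_eq (ae_restrict_of_ae (h.mono fun x hx => hx.symm)),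
      (MemLp.zero' (ε := ℝ)).ae_eq (ae_restrict_of_ae ?_)⟩, h.mono fun x hx _ => hx⟩
    filter_upwards [ae_fst_snd h] with p hp
    rw [hp.1, hp.2]; simp
  smul_mem' := by
    rintro c u ⟨⟨hu1, hu2⟩, hu3⟩
    have h := AEEqFun.coeFn_smul c u
    refine ⟨⟨(hu1.const_smul c).ae_eq (ae_restrict_of_ae h.symm), (hu2.const_smul c).ae_eq
      (ae_restrict_of_ae ?_)⟩, ?_⟩
    · filter_upwards [ae_fst_snd h] with p hp
      simp only [Pi.smul_apply, smul_eq_mul] at hp ⊢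
      rw [hp.1, hp.2]; ring
    · filter_upwards [h, hu3] with x hx h1 hxΩ
      rw [hx, Pi.smul_apply, h1 hxΩ, smul_zero]

/-- The space `X₀` attached to `Ω` and `K`. -/
def X0 (_h : NonlocalSetting s Ω K) : Type := X0Submodule Ω K

variable (h : NonlocalSetting s Ω K)

noncomputable instance : AddCommGroup h.X0 := inferInstanceAs (AddCommGroup (X0Submodule Ω K))

noncomputable instance : Module ℝ h.X0 := inferInstanceAs (Module ℝ (X0Submodule Ω K))

/-- An element of `X₀` as a function on `ℝⁿ` (a representative of its class). -/
noncomputable instance : CoeFun h.X0 (fun _ => EuclideanSpace ℝ (Fin n) → ℝ) where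
  coe u := ((u.1 : EuclideanSpace ℝ (Fin n) →ₘ[volume] ℝ) : EuclideanSpace ℝ (Fin n) → ℝ)

variable {h}

theorem X0.coeFn_add (u v : h.X0) : ∀ᵐ x, (u + v) x = u x + v x := AEEqFun.coeFn_add u.1 v.1

theorem X0.coeFn_smul (c : ℝ) (u : h.X0) : ∀ᵐ x, (c • u) x = c * u x := AEEqFun.coeFn_smul c u.1

theorem X0.memX (u : h.X0) : MemX Ω K u := u.2.1

theorem X0.ae_eq_zero (u : h.X0) : ∀ᵐ x, x ∈ Ωᶜ → u x = 0 := u.2.2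

theorem X0.memLp (u : h.X0) :
    MemLp (fun p : EuclideanSpace ℝ (Fin n) × EuclideanSpace ℝ (Fin n) =>
      (u p.1 - u p.2) * √(K (p.1 - p.2))) 2 volume := by
  have hm : MeasurableSet ((Ωᶜ ×ˢ Ωᶜ)ᶜ :
      Set (EuclideanSpace ℝ (Fin n) × EuclideanSpace ℝ (Fin n))) :=
    (h.isOpen.measurableSet.compl.prod h.isOpen.measurableSet.compl).compl
  refine ((memLp_indicator_iff_restrict hm).2 u.memX.2).ae_eq ?_
  filter_upwards [ae_fst_snd u.ae_eq_zero] with p hp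
  by_cases hpΩ : p ∈ ((Ωᶜ ×ˢ Ωᶜ)ᶜ : Set (EuclideanSpace ℝ (Fin n) × EuclideanSpace ℝ (Fin n)))
  · rw [Set.indicator_of_mem hpΩ]
  · rw [Set.indicator_of_notMem hpΩ]
    rw [Set.notMem_compl_iff] at hpΩ
    rw [hp.1 hpΩ.1, hp.2 hpΩ.2]; simp

theorem X0.integrable (u v : h.X0) :
    Integrable (fun p : EuclideanSpace ℝ (Fin n) × EuclideanSpace ℝ (Fin n) =>
      (u p.1 - u p.2) * (v p.1 - v p.2) * K (p.1 - p.2)) volume := by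
  refine (u.memLp.integrable_mul v.memLp).congr (ae_of_all _ fun p => ?_)
  simp only [Pi.mul_apply]
  by_cases hp : p.1 = p.2
  · simp [hp]
  · have hK := Real.mul_self_sqrt (h.kernel_pos _ (sub_ne_zero.2 hp)).le
    linear_combination (u p.1 - u p.2) * (v p.1 - v p.2) * hK

theorem volume_compl_ne_zero (h : NonlocalSetting s Ω K) : volume Ωᶜ ≠ 0 := by
  intro h0
  have hn : n ≠ 0 := by
    rintro rfl
    have h1 := h.s_pos
    have h2 := h.two_s_lt
    simp only [Nat.cast_zero] at h2
    linarith
  have : NeZero n := ⟨hn⟩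
  have : NoncompactSpace (EuclideanSpace ℝ (Fin n)) := NormedSpace.noncompactSpace ℝ _
  have h1 : volume (Ω ∪ Ωᶜ) ≤ volume Ω + volume Ωᶜ := measure_union_le _ _
  rw [Set.union_compl_self, measure_univ_of_isAddLeftInvariant, h0, add_zero] at h1
  exact absurd h.isBounded.measure_lt_top (not_lt.2 h1)

/-- The scalar product `⟨u, v⟩ = ∫∫ (u x - u y) (v x - v y) K (x - y) dx dy` on `X₀`. -/
@[reducible]
noncomputable def X0.core (h : NonlocalSetting s Ω K) : InnerProductSpace.Core ℝ h.X0 where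
  inner u v := ∫ p : EuclideanSpace ℝ (Fin n) × EuclideanSpace ℝ (Fin n),
    (u p.1 - u p.2) * (v p.1 - v p.2) * K (p.1 - p.2)
  conj_inner_symm u v := by
    simp only [conj_trivial]
    exact integral_congr_ae (ae_of_all _ fun p => by ring)
  re_inner_nonneg u := by
    simp only [RCLike.re_to_real]
    refine integral_nonneg fun p => ?_
    by_cases hp : p.1 = p.2
    · simp [hp]
    · exact mul_nonneg (mul_self_nonneg _) (h.kernel_pos _ (sub_ne_zero.2 hp)).le
  add_left u v w := by
    rw [← integral_add (X0.integrable u w) (X0.integrable v w)]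
    refine integral_congr_ae ?_
    filter_upwards [ae_fst_snd (X0.coeFn_add u v)] with p hp
    rw [hp.1, hp.2]; ring
  smul_left u v c := by
    simp only [conj_trivial]
    rw [← integral_const_mul]
    refine integral_congr_ae ?_
    filter_upwards [ae_fst_snd (X0.coeFn_smul c u)] with p hp
    rw [hp.1, hp.2]; ring
  definite u hu := by
    have hnn : ∀ p : EuclideanSpace ℝ (Fin n) × EuclideanSpace ℝ (Fin n),
        0 ≤ (u p.1 - u p.2) * (u p.1 - u p.2) * K (p.1 - p.2) := fun p => by
      by_cases hp : p.1 = p.2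
      · simp [hp]
      · exact mul_nonneg (mul_self_nonneg _) (h.kernel_pos _ (sub_ne_zero.2 hp)).le
    have h1 := (integral_eq_zero_iff_of_nonneg hnn (X0.integrable u u)).1 hu
    have h2 : ∀ᵐ p : EuclideanSpace ℝ (Fin n) × EuclideanSpace ℝ (Fin n), u p.1 = u p.2 := by
      filter_upwards [h1] with p hp
      by_cases hne : p.1 = p.2
      · rw [hne]
      · have hK := (h.kernel_pos _ (sub_ne_zero.2 hne)).ne'
        simp only [Pi.zero_apply, mul_eq_zero, or_self, hK, or_false] at hp
        exact sub_eq_zero.1 hp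
    have h3 : ∀ᵐ x, u x = 0 := by
      filter_upwards [Measure.ae_ae_of_ae_prod h2] with x hx
      have h4 : ∃ᵐ y, y ∈ Ωᶜ := frequently_ae_mem_iff.2 h.volume_compl_ne_zero
      obtain ⟨y, hy, hxy, hy0⟩ := (h4.and_eventually (hx.and u.ae_eq_zero)).exists
      exact hxy.trans (hy0 hy)
    refine Subtype.ext (AEEqFun.ext ?_)
    have h5 : (fun x => u x) =ᵐ[volume] 0 := h3
    exact h5.trans (AEEqFun.coeFn_zero (α := EuclideanSpace ℝ (Fin n)) (β := ℝ)).symm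

noncomputable instance : NormedAddCommGroup h.X0 := (X0.core h).toNormedAddCommGroup

noncomputable instance : InnerProductSpace ℝ h.X0 := InnerProductSpace.ofCore (X0.core h).toCore

/-- The norm of `X₀` is `(∫∫ |u x - u y|² K (x - y) dx dy)^{1/2}`. -/
theorem X0.norm_eq (u : h.X0) :
    ‖u‖ = √(∫ p : EuclideanSpace ℝ (Fin n) × EuclideanSpace ℝ (Fin n),
      |u p.1 - u p.2| ^ 2 * K (p.1 - p.2)) := by
  have h1 : ‖u‖ = √(∫ p : EuclideanSpace ℝ (Fin n) × EuclideanSpace ℝ (Fin n),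
      (u p.1 - u p.2) * (u p.1 - u p.2) * K (p.1 - p.2)) := rfl
  rw [h1]
  simp only [sq_abs]
  simp only [sq]

end NonlocalSetting

/-- `F(x, t) = ∫₀ᵗ f(x, τ) dτ`. -/
noncomputable def primitive {n : ℕ} (f : EuclideanSpace ℝ (Fin n) → ℝ → ℝ)
    (x : EuclideanSpace ℝ (Fin n)) (t : ℝ) : ℝ :=
  ∫ τ in (0 : ℝ)..t, f x τ

/-- `𝓕(x, t) = ½ t f(x, t) - F(x, t)`. -/
noncomputable def jeanjeanFun {n : ℕ} (f : EuclideanSpace ℝ (Fin n) → ℝ → ℝ)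
    (x : EuclideanSpace ℝ (Fin n)) (t : ℝ) : ℝ :=
  1 / 2 * t * f x t - primitive f x t

/-- The energy functional
`J(u) = ½ ∫∫ |u x - u y|² K (x - y) dx dy - (lam / 2) ∫_Ω |u|² dx - ∫_Ω F(x, u x) dx` on `X₀`. -/
noncomputable def energy {n : ℕ} {s : ℝ} {Ω : Set (EuclideanSpace ℝ (Fin n))}
    {K : EuclideanSpace ℝ (Fin n) → ℝ} (h : NonlocalSetting s Ω K)
    (f : EuclideanSpace ℝ (Fin n) → ℝ → ℝ) (lam : ℝ) (u : h.X0) : ℝ :=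
  1 / 2 * (∫ p : EuclideanSpace ℝ (Fin n) × EuclideanSpace ℝ (Fin n),
      |u p.1 - u p.2| ^ 2 * K (p.1 - p.2))
    - lam / 2 * (∫ x in Ω, |u x| ^ 2)
    - ∫ x in Ω, primitive f x (u x)

/-- The Cerami compactness condition at level `c` for a functional `J` on a normed space, with
`J'` the Fréchet derivative. -/
def CeramiCondition {E : Type*} [NormedAddCommGroup E] [NormedSpace ℝ E] (J : E → ℝ) (c : ℝ) :
    Prop :=
  ∀ u : ℕ → E, Tendsto (fun j => J (u j)) atTop (𝓝 c) →
    Tendsto (fun j => (1 + ‖u j‖) * sSup {r : ℝ | ∃ φ : E, ‖φ‖ = 1 ∧ r = |fderiv ℝ J (u j) φ|})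
      atTop (𝓝 0) →
    ∃ k : ℕ → ℕ, StrictMono k ∧ ∃ v : E, Tendsto (fun j => u (k j)) atTop (𝓝 v)

/-!
The functional is analysed through the Sobolev embedding `ι : X₀ → L^q(Ω)`. The quadratic term in
`lam` is absorbed into the nonlinearity: with `g(x, t) = lam t + f(x, t)` and primitive `G`, the
energy is `½ ‖u‖² - ∫ G(x, ι u)`, the function `½ t g - G` equals `½ t f - F`, and `G` is still
superquadratic. Two facts are then needed: a variational one about such functionals on a Hilbert
space with a compact map `ι` into `L^q`, and the compactness of `ι`.

*Variational part.* `w ↦ ∫ G(x, w)` is Fréchet differentiable on `L^q` because the remainder of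
the difference quotient tends to zero in the conjugate Lebesgue space
(`IsGrowthPotential.hasFDerivAt_integral`). A bounded Cerami sequence has a convergent subsequence
by compactness of `ι` (`exists_subseq_tendsto_of_bounded`). A Cerami sequence cannot have
`‖u j‖ → ∞`: normalize, and let `v` be an `L^q` limit of `ι (u j / ‖u j‖)`. Superquadraticity gives
`M ∫ v² ≤ ½` for every `M`, so `v = 0` (`eq_zero_of_tendsto_normalized`). But then the energy at
`R u j / ‖u j‖` tends to `R² / 2`, for every `R`, while the maximum of the energy on the segment
`[0, u j]` stays bounded: at an interior maximum the energy is `∫ (½ t g - G)`, which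
quasi-monotonicity compares with its value at `u j` (`action_smul_le`).

*Compactness part.* Only the lower bound on the kernel is used. Comparing the superlevel sets of
`u` at heights `t` and `2 t` and iterating over dyadic heights yields weak integrability to the
critical exponent, hence the embedding into `L^q(Ω)` for subcritical `q`
(`NonlocalSetting.exists_measure_superlevel_le`, `exists_measure_dyadic_le`). Compactness in
`L²(Ω)` follows by comparing `u` with its averages over small balls (`exists_integral_sq_le`),
which converge along weakly convergent subsequences, and passes to `L^q(Ω)` by interpolation.
Completeness of `X₀` comes from the isometry `u ↦ (u x - u y) √(K (x - y))` into `L²`.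
-/

/-! ### Potentials with subcritical growth -/

/-- `G : α → ℝ → ℝ` is a Carathéodory potential with `t`-derivative `g` and `G x 0 = 0`, where `g`
grows at most like `|t| ^ (q - 1)`, uniformly for `μ`-almost every `x`. -/
structure IsGrowthPotential {α : Type*} [MeasurableSpace α] (μ : Measure α) (q : ℝ)
    (g G : α → ℝ → ℝ) : Prop where
  one_lt : 1 < q
  measurable_deriv : Measurable (Function.uncurry g)
  measurable : Measurable (Function.uncurry G)
  continuous_deriv : ∀ x, Continuous (g x)
  hasDerivAt : ∀ x t, HasDerivAt (G x) (g x t) t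
  zero : ∀ x, G x 0 = 0
  growth : ∃ C : ℝ, 0 ≤ C ∧ ∀ᵐ x ∂μ, ∀ t, |g x t| ≤ C * (1 + |t| ^ (q - 1))

namespace IsGrowthPotential

theorem abs_sub_le_mul_of_hasDerivAt {F F' : ℝ → ℝ} (h : ∀ t, HasDerivAt F (F' t) t) {t k M : ℝ}
    (hM : ∀ ξ, |ξ - t| ≤ |k| → |F' ξ| ≤ M) : |F (t + k) - F t| ≤ M * |k| := by
  have h1 := (convex_closedBall t |k|).norm_image_sub_le_of_norm_hasDerivWithin_le
    (f := F) (f' := F') (C := M) (fun x _ => (h x).hasDerivWithinAt)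
    (fun x hx => hM x (by simpa [Real.dist_eq] using hx)) (x := t) (y := t + k)
    (by simp) (by simp)
  simpa using h1

/-- The difference quotient of `G x` at `t` with increment `k`, minus the derivative; it is `0`
for `k = 0`, as division by zero gives zero. -/
noncomputable def remainder {α : Type*} (g G : α → ℝ → ℝ) (x : α) (t k : ℝ) : ℝ :=
  (G x (t + k) - G x t - g x t * k) / k

theorem remainder_mul {α : Type*} (g G : α → ℝ → ℝ) (x : α) (t k : ℝ) :
    remainder g G x t k * k = G x (t + k) - G x t - g x t * k := by
  by_cases hk : k = 0
  · simp [hk]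
  · rw [remainder, div_mul_cancel₀ _ hk]

variable {α : Type*} [MeasurableSpace α] {μ : Measure α} {q : ℝ} {g G : α → ℝ → ℝ}

theorem abs_remainder_le (hG : IsGrowthPotential μ q g G) {x : α} {t k M : ℝ}
    (hM : ∀ ξ, |ξ - t| ≤ |k| → |g x ξ - g x t| ≤ M) : |remainder g G x t k| ≤ M := by
  have hM0 : 0 ≤ M := le_trans (abs_nonneg _) (hM t (by simp))
  have h1 := abs_sub_le_mul_of_hasDerivAt (F := fun τ => G x τ - g x t * τ)
    (F' := fun τ => g x τ - g x t) (t := t) (k := k) (M := M)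
    (fun τ => by
      have h2 := (hG.hasDerivAt x τ).sub ((hasDerivAt_id τ).const_mul (g x t))
      rw [mul_one] at h2
      exact h2) hM
  rw [remainder, abs_div]
  refine div_le_of_le_mul₀ (abs_nonneg _) hM0 (le_trans (le_of_eq ?_) h1)
  congr 1; ring

theorem tendsto_remainder (hG : IsGrowthPotential μ q g G) (x : α) (t : ℝ) :
    Tendsto (remainder g G x t) (𝓝 0) (𝓝 0) := by
  rw [Metric.tendsto_nhds_nhds]
  intro ε hε
  obtain ⟨δ, hδ, h⟩ := Metric.continuous_iff.1 (hG.continuous_deriv x) t (ε / 2) (by positivity)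
  refine ⟨δ, hδ, fun k hk => ?_⟩
  rw [Real.dist_eq, sub_zero] at hk ⊢
  refine lt_of_le_of_lt (hG.abs_remainder_le (M := ε / 2) fun ξ hξ => ?_) (by linarith)
  exact (h ξ (lt_of_le_of_lt hξ hk)).le

theorem growth_le (hG : IsGrowthPotential μ q g G) {x : α} {C : ℝ} (hC : 0 ≤ C)
    (hx : ∀ t, |g x t| ≤ C * (1 + |t| ^ (q - 1))) {t m : ℝ} (htm : |t| ≤ m) :
    |g x t| ≤ C * (1 + m ^ (q - 1)) := by
  have := hG.one_lt
  refine (hx t).trans ?_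
  gcongr

theorem abs_potential_le (hG : IsGrowthPotential μ q g G) {x : α} {C : ℝ} (hC : 0 ≤ C)
    (hx : ∀ t, |g x t| ≤ C * (1 + |t| ^ (q - 1))) (t : ℝ) :
    |G x t| ≤ 2 * C * (1 + |t| ^ q) := by
  have hq := hG.one_lt
  have h1 := abs_sub_le_mul_of_hasDerivAt (F := G x) (F' := g x) (hG.hasDerivAt x) (t := 0)
    (k := t) (M := C * (1 + |t| ^ (q - 1)))
    (fun ξ hξ => hG.growth_le hC hx (by simpa using hξ))
  rw [zero_add, hG.zero, sub_zero] at h1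
  have h2 : |t| ^ (q - 1) * |t| = |t| ^ q := by
    rcases eq_or_ne t 0 with rfl | ht
    · simp [Real.zero_rpow (by linarith : q ≠ 0)]
    · rw [Real.rpow_sub_one (abs_pos.2 ht).ne']
      field_simp
  have h3 : |t| ≤ 1 + |t| ^ q := by
    rcases le_total |t| 1 with h | h
    · have : 0 ≤ |t| ^ q := by positivity
      linarith
    · have := Real.self_le_rpow_of_one_le h hq.le
      linarith
  have h4 : 0 ≤ |t| ^ q := by positivity
  calc |G x t| ≤ C * (|t| + |t| ^ (q - 1) * |t|) := by linarith
    _ ≤ C * (2 * (1 + |t| ^ q)) := by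
        rw [h2]; gcongr; linarith
    _ = _ := by ring

/-- The power of order `q / (q - 1)` of an expression of growth `q - 1` has growth `q`. -/
theorem exists_rpow_growth_le (hq : 1 < q) {C : ℝ} (hC : 0 ≤ C) :
    ∃ D : ℝ, 0 ≤ D ∧ ∀ t k r : ℝ, |r| ≤ C * (1 + (|t| + |k|) ^ (q - 1)) →
      |r| ^ (q / (q - 1)) ≤ D * (1 + |t| ^ q + |k| ^ q) := by
  have hq1 : 0 < q - 1 := by linarith
  refine ⟨(C * (1 + 2 ^ (q - 1))) ^ (q / (q - 1)), by positivity, fun t k r hr => ?_⟩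
  set m := max 1 (max |t| |k|) with hm
  have hm1 : 1 ≤ m := le_max_left _ _
  have htm : |t| ≤ m := (le_max_left _ _).trans (le_max_right _ _)
  have hkm : |k| ≤ m := (le_max_right _ _).trans (le_max_right _ _)
  have h1 : |r| ≤ C * (1 + 2 ^ (q - 1)) * m ^ (q - 1) := by
    refine hr.trans ?_
    rw [mul_assoc]
    gcongr
    have h2 : (|t| + |k|) ^ (q - 1) ≤ (2 * m) ^ (q - 1) := by gcongr; linarith
    rw [Real.mul_rpow (by norm_num) (by linarith)] at h2
    have h3 : 1 ≤ m ^ (q - 1) := Real.one_le_rpow hm1 hq1.le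
    linarith
  have h4 : |r| ^ (q / (q - 1)) ≤ (C * (1 + 2 ^ (q - 1))) ^ (q / (q - 1)) * m ^ q := by
    calc |r| ^ (q / (q - 1)) ≤ (C * (1 + 2 ^ (q - 1)) * m ^ (q - 1)) ^ (q / (q - 1)) := by
          gcongr
      _ = _ := by
          rw [Real.mul_rpow (by positivity) (by positivity), ← Real.rpow_mul (by linarith)]
          congr 2; field_simp
  refine h4.trans ?_
  gcongr
  have ht0 : 0 ≤ |t| ^ q := by positivity
  have hk0 : 0 ≤ |k| ^ q := by positivity
  rcases max_choice 1 (max |t| |k|) with h | h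
  · rw [hm, h, Real.one_rpow]; linarith
  · rcases max_choice |t| |k| with h' | h'
    · rw [hm, h, h']; linarith
    · rw [hm, h, h']; linarith

theorem ae_abs_remainder_le (hG : IsGrowthPotential μ q g G) :
    ∃ C : ℝ, 0 ≤ C ∧ ∀ᵐ x ∂μ, ∀ t k,
      |remainder g G x t k| ≤ C * (1 + (|t| + |k|) ^ (q - 1)) := by
  obtain ⟨C, hC, h⟩ := hG.growth
  refine ⟨2 * C, by positivity, h.mono fun x hx t k => hG.abs_remainder_le fun ξ hξ => ?_⟩
  have h1 : |ξ| ≤ |t| + |k| := by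
    have := abs_add_le (ξ - t) t
    rw [sub_add_cancel] at this
    linarith
  have h2 := hG.growth_le hC hx h1
  have h3 := hG.growth_le hC hx (m := |t| + |k|) (t := t) (by linarith [abs_nonneg k])
  have := abs_sub (g x ξ) (g x t)
  linarith

/-- The square of the `L²` norm is an integral functional of the same kind; this yields its
continuity on `L^q`. -/
theorem sq_isGrowthPotential (hq : 2 ≤ q) :
    IsGrowthPotential μ q (fun _ t => 2 * t) (fun _ t => t ^ 2) where
  one_lt := by linarith
  measurable_deriv := by fun_prop
  measurable := by fun_prop
  continuous_deriv _ := by fun_prop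
  hasDerivAt _ t := by simpa using hasDerivAt_pow 2 t
  zero _ := by simp
  growth := by
    refine ⟨2, by norm_num, ae_of_all _ fun x t => ?_⟩
    rw [abs_mul, abs_two]
    gcongr
    rcases le_total |t| 1 with h | h
    · have : 0 ≤ |t| ^ (q - 1) := by positivity
      linarith
    · have := Real.self_le_rpow_of_one_le h (by linarith : 1 ≤ q - 1)
      linarith

end IsGrowthPotential

/-! ### Integral functionals on `L^q` -/

namespace IsGrowthPotential

variable {α : Type*} [MeasurableSpace α] {μ : Measure α} {q : ℝ} {g G : α → ℝ → ℝ}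

theorem aestronglyMeasurable_deriv_comp (hG : IsGrowthPotential μ q g G) {w : α → ℝ}
    (hw : AEStronglyMeasurable w μ) : AEStronglyMeasurable (fun x => g x (w x)) μ :=
  (hG.measurable_deriv.comp_aemeasurable
    (aemeasurable_id.prodMk hw.aemeasurable)).aestronglyMeasurable

theorem aestronglyMeasurable_comp (hG : IsGrowthPotential μ q g G) {w : α → ℝ}
    (hw : AEStronglyMeasurable w μ) : AEStronglyMeasurable (fun x => G x (w x)) μ :=
  (hG.measurable.comp_aemeasurable (aemeasurable_id.prodMk hw.aemeasurable)).aestronglyMeasurable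

theorem aestronglyMeasurable_remainder (hG : IsGrowthPotential μ q g G) {w k : α → ℝ}
    (hw : AEStronglyMeasurable w μ) (hk : AEStronglyMeasurable k μ) :
    AEStronglyMeasurable (fun x => remainder g G x (w x) (k x)) μ := by
  have h1 := hG.aestronglyMeasurable_comp (hw.add hk)
  have h2 := hG.aestronglyMeasurable_comp hw
  have h3 := hG.aestronglyMeasurable_deriv_comp hw
  exact (((h1.sub h2).sub (h3.mul hk)).aemeasurable.div hk.aemeasurable).aestronglyMeasurable

theorem integrable_abs_rpow (hq : 1 < q) {w : α → ℝ}
    (hw : MemLp w (ENNReal.ofReal q) μ) : Integrable (fun x => |w x| ^ q) μ := by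
  have h := hw.integrable_norm_rpow (by simp; linarith) ENNReal.ofReal_ne_top
  rwa [ENNReal.toReal_ofReal (by linarith)] at h

theorem memLp_of_growth [IsFiniteMeasure μ] (hq : 1 < q) {C : ℝ} {w r : α → ℝ}
    (hw : MemLp w (ENNReal.ofReal q) μ) (hr : AEStronglyMeasurable r μ)
    (h : ∀ᵐ x ∂μ, |r x| ≤ C * (1 + |w x| ^ (q - 1))) :
    MemLp r (ENNReal.ofReal (q / (q - 1))) μ := by
  have h1 := hw.norm_rpow_div (ENNReal.ofReal (q - 1))
  rw [ENNReal.toReal_ofReal (by linarith), ← ENNReal.ofReal_div_of_pos (by linarith)] at h1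
  refine (((memLp_const (1 : ℝ)).add h1).const_mul C).mono hr (h.mono fun x hx => ?_)
  exact hx.trans (le_abs_self _)

theorem memLp_deriv_comp [IsFiniteMeasure μ] (hG : IsGrowthPotential μ q g G) {w : α → ℝ}
    (hw : MemLp w (ENNReal.ofReal q) μ) :
    MemLp (fun x => g x (w x)) (ENNReal.ofReal (q / (q - 1))) μ := by
  obtain ⟨C, -, h⟩ := hG.growth
  exact memLp_of_growth hG.one_lt hw (hG.aestronglyMeasurable_deriv_comp hw.1)
    (h.mono fun x hx => hx _)

theorem memLp_remainder [IsFiniteMeasure μ] (hG : IsGrowthPotential μ q g G) {w k : α → ℝ}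
    (hw : MemLp w (ENNReal.ofReal q) μ) (hk : MemLp k (ENNReal.ofReal q) μ) :
    MemLp (fun x => remainder g G x (w x) (k x)) (ENNReal.ofReal (q / (q - 1))) μ := by
  obtain ⟨C, -, h⟩ := hG.ae_abs_remainder_le
  refine memLp_of_growth (C := C) (w := fun x => |w x| + |k x|) hG.one_lt (hw.abs.add hk.abs)
    (hG.aestronglyMeasurable_remainder hw.1 hk.1) (h.mono fun x hx => ?_)
  rw [abs_of_nonneg (by positivity : 0 ≤ |w x| + |k x|)]
  exact hx _ _

theorem integrable_comp [IsFiniteMeasure μ] (hG : IsGrowthPotential μ q g G) {w : α → ℝ}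
    (hw : MemLp w (ENNReal.ofReal q) μ) : Integrable (fun x => G x (w x)) μ := by
  obtain ⟨C, hC, h⟩ := hG.growth
  refine (((integrable_const (1 : ℝ)).add (integrable_abs_rpow hG.one_lt hw)).const_mul
    (2 * C)).mono (hG.aestronglyMeasurable_comp hw.1) (h.mono fun x hx => ?_)
  exact (hG.abs_potential_le hC hx (w x)).trans (le_abs_self _)

/-- Dominated convergence with a bound `ψ x + φ i x` whose varying part `φ i` tends to zero
in `L¹`. -/
theorem tendsto_integral_zero_of_le_add {r φ : ℕ → α → ℝ} {ψ : α → ℝ}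
    (hr : ∀ i, AEStronglyMeasurable (r i) μ) (hr0 : ∀ i x, 0 ≤ r i x)
    (hψ : Integrable ψ μ) (hφ : ∀ i, Integrable (φ i) μ) (hφ0 : ∀ i x, 0 ≤ φ i x)
    (hle : ∀ i, ∀ᵐ x ∂μ, r i x ≤ ψ x + φ i x)
    (hφt : Tendsto (fun i => ∫ x, φ i x ∂μ) atTop (𝓝 0))
    (hrt : ∀ᵐ x ∂μ, Tendsto (fun i => r i x) atTop (𝓝 0)) :
    Tendsto (fun i => ∫ x, r i x ∂μ) atTop (𝓝 0) := by
  have hm : ∀ i, AEStronglyMeasurable (fun x => max (r i x - φ i x) 0) μ := fun i =>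
    (((hr i).sub (hφ i).1).aemeasurable.max aemeasurable_const).aestronglyMeasurable
  have hb : ∀ i, ∀ᵐ x ∂μ, ‖max (r i x - φ i x) 0‖ ≤ |ψ x| := fun i => by
    filter_upwards [hle i] with x hx
    rw [Real.norm_of_nonneg (le_max_right _ _)]
    exact max_le ((by linarith : r i x - φ i x ≤ ψ x).trans (le_abs_self _)) (abs_nonneg _)
  have h1 : Tendsto (fun i => ∫ x, max (r i x - φ i x) 0 ∂μ) atTop (𝓝 (∫ _, 0 ∂μ)) := by
    refine tendsto_integral_of_dominated_convergence (fun x => |ψ x|) hm hψ.abs hb ?_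
    filter_upwards [hrt] with x hx
    refine tendsto_of_tendsto_of_tendsto_of_le_of_le tendsto_const_nhds hx
      (fun i => le_max_right _ _) (fun i => max_le ?_ (hr0 i x))
    linarith [hφ0 i x]
  rw [integral_zero] at h1
  have h2 := h1.add hφt
  rw [add_zero] at h2
  refine tendsto_of_tendsto_of_tendsto_of_le_of_le tendsto_const_nhds h2
    (fun i => integral_nonneg (hr0 i)) (fun i => ?_)
  have hi : Integrable (fun x => max (r i x - φ i x) 0) μ := hψ.abs.mono' (hm i) (hb i)
  rw [← integral_add hi (hφ i)]
  refine integral_mono_of_nonneg (ae_of_all _ (hr0 i)) (hi.add (hφ i)) (ae_of_all _ fun x => ?_)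
  have := le_max_left (r i x - φ i x) 0
  dsimp only [Pi.add_apply]
  linarith

theorem norm_rpow_eq_integral (hq : 1 < q) (w : Lp ℝ (ENNReal.ofReal q) μ) :
    ∫ x, |w x| ^ q ∂μ = ‖w‖ ^ q := by
  have h := (Lp.memLp w).eLpNorm_eq_integral_rpow_norm (by simp; linarith) ENNReal.ofReal_ne_top
  rw [ENNReal.toReal_ofReal (by linarith)] at h
  have h0 : 0 ≤ ∫ x, ‖w x‖ ^ q ∂μ := integral_nonneg fun x => by positivity
  rw [Lp.norm_def, h, ENNReal.toReal_ofReal (by positivity), ← Real.rpow_mul h0,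
    inv_mul_cancel₀ (by linarith), Real.rpow_one]
  rfl

theorem holderConjugate (hG : IsGrowthPotential μ q g G) : (q / (q - 1)).HolderConjugate q :=
  (Real.HolderConjugate.conjExponent hG.one_lt).symm

theorem holderConjugate_ofReal (hG : IsGrowthPotential μ q g G) :
    (ENNReal.ofReal (q / (q - 1))).HolderConjugate (ENNReal.ofReal q) := by
  have h1 := hG.holderConjugate
  constructor
  have h2 := h1.inv_add_inv_eq_inv
  rw [← ENNReal.ofReal_inv_of_pos h1.pos, ← ENNReal.ofReal_inv_of_pos h1.symm.pos,
    ← ENNReal.ofReal_add (inv_nonneg.2 h1.nonneg) (inv_nonneg.2 h1.symm.nonneg), h2]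
  simp

theorem integrable_deriv_mul [IsFiniteMeasure μ] (hG : IsGrowthPotential μ q g G) {w φ : α → ℝ}
    (hw : MemLp w (ENNReal.ofReal q) μ) (hφ : MemLp φ (ENNReal.ofReal q) μ) :
    Integrable (fun x => g x (w x) * φ x) μ :=
  have := hG.holderConjugate_ofReal
  (hG.memLp_deriv_comp hw).integrable_mul hφ

variable [Fact (1 ≤ ENNReal.ofReal q)]

/-- A sequence converging in `L^q` has a subsequence converging almost everywhere. -/
theorem exists_subseq_ae_tendsto {w : ℕ → Lp ℝ (ENNReal.ofReal q) μ}
    {v : Lp ℝ (ENNReal.ofReal q) μ} (h : Tendsto w atTop (𝓝 v)) :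
    ∃ k : ℕ → ℕ, StrictMono k ∧ ∀ᵐ x ∂μ, Tendsto (fun i => w (k i) x) atTop (𝓝 (v x)) :=
  (tendstoInMeasure_of_tendsto_Lp h).exists_seq_tendsto_ae

theorem tendsto_integral_remainder [IsFiniteMeasure μ] (hG : IsGrowthPotential μ q g G)
    (w : Lp ℝ (ENNReal.ofReal q) μ) :
    Tendsto (fun k : Lp ℝ (ENNReal.ofReal q) μ =>
      ∫ x, |remainder g G x (w x) (k x)| ^ (q / (q - 1)) ∂μ) (𝓝 0) (𝓝 0) := by
  have hq := hG.one_lt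
  have hq' : 0 < q / (q - 1) := div_pos (by linarith) (by linarith)
  refine tendsto_of_subseq_tendsto fun φ hφ => ?_
  obtain ⟨k, hk, hae⟩ := exists_subseq_ae_tendsto hφ
  refine ⟨k, ?_⟩
  obtain ⟨C, hC, hrem⟩ := hG.ae_abs_remainder_le
  obtain ⟨D, hD, hpow⟩ := exists_rpow_growth_le hq hC
  refine tendsto_integral_zero_of_le_add (ψ := fun x => D * (1 + |w x| ^ q))
    (φ := fun i x => D * |φ (k i) x| ^ q) ?_ ?_ ?_ ?_ ?_ ?_ ?_ ?_
  · intro i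
    exact ((hG.aestronglyMeasurable_remainder (Lp.aestronglyMeasurable w)
      (Lp.aestronglyMeasurable _)).norm.aemeasurable.pow_const _).aestronglyMeasurable
  · intro i x; positivity
  · exact ((integrable_const (1 : ℝ)).add (integrable_abs_rpow hq (Lp.memLp w))).const_mul D
  · exact fun i => (integrable_abs_rpow hq (Lp.memLp _)).const_mul D
  · intro i x; positivity
  · intro i
    filter_upwards [hrem] with x hx
    refine (hpow _ _ _ (hx (w x) (φ (k i) x))).trans (le_of_eq ?_)
    ring
  · have h1 : Tendsto (fun i => D * ‖φ (k i)‖ ^ q) atTop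
        (𝓝 (D * ‖(0 : Lp ℝ (ENNReal.ofReal q) μ)‖ ^ q)) :=
      (((hφ.comp hk.tendsto_atTop).norm).rpow_const (Or.inr (by linarith))).const_mul D
    rw [norm_zero, Real.zero_rpow (by linarith), mul_zero] at h1
    refine h1.congr fun i => ?_
    rw [integral_const_mul, norm_rpow_eq_integral hq]
  · filter_upwards [hae, Lp.coeFn_zero ℝ (ENNReal.ofReal q) μ] with x hx h0
    rw [h0] at hx
    have h1 := ((hG.tendsto_remainder x (w x)).comp hx).abs.rpow_const (p := q / (q - 1))
      (Or.inr hq'.le)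
    rwa [abs_zero, Real.zero_rpow hq'.ne'] at h1

variable [IsFiniteMeasure μ]

/-- The functional `φ ↦ ∫ g(x, w x) φ x` on `L^q`. -/
noncomputable def derivative (hG : IsGrowthPotential μ q g G) (w : Lp ℝ (ENNReal.ofReal q) μ) :
    Lp ℝ (ENNReal.ofReal q) μ →L[ℝ] ℝ :=
  have : (ENNReal.ofReal (q / (q - 1))).HolderConjugate (ENNReal.ofReal q) :=
    hG.holderConjugate_ofReal
  have : Fact (1 ≤ ENNReal.ofReal (q / (q - 1))) :=
    ⟨by rw [ENNReal.one_le_ofReal]; exact hG.holderConjugate.lt.le⟩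
  (ContinuousLinearMap.mul ℝ ℝ).lpPairing μ (ENNReal.ofReal (q / (q - 1))) (ENNReal.ofReal q)
    (hG.memLp_deriv_comp (Lp.memLp w)).toLp

theorem derivative_apply (hG : IsGrowthPotential μ q g G) (w φ : Lp ℝ (ENNReal.ofReal q) μ) :
    hG.derivative w φ = ∫ x, g x (w x) * φ x ∂μ := by
  rw [derivative, ContinuousLinearMap.lpPairing_eq_integral]
  refine integral_congr_ae ?_
  filter_upwards [(hG.memLp_deriv_comp (Lp.memLp w)).coeFn_toLp] with x hx
  rw [hx]; rfl

/-- The functional `w ↦ ∫ G(x, w x)` is Fréchet differentiable on `L^q`. -/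
theorem hasFDerivAt_integral (hG : IsGrowthPotential μ q g G) (w : Lp ℝ (ENNReal.ofReal q) μ) :
    HasFDerivAt (fun v : Lp ℝ (ENNReal.ofReal q) μ => ∫ x, G x (v x) ∂μ) (hG.derivative w) w := by
  have hq := hG.one_lt
  have hc := hG.holderConjugate
  have := hG.holderConjugate_ofReal
  have key : ∀ k : Lp ℝ (ENNReal.ofReal q) μ,
      ‖(∫ x, G x ((w + k) x) ∂μ) - (∫ x, G x (w x) ∂μ) - hG.derivative w k‖ ≤
        (∫ x, |remainder g G x (w x) (k x)| ^ (q / (q - 1)) ∂μ) ^ (1 / (q / (q - 1))) * ‖k‖ := by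
    intro k
    have h1 : (∫ x, G x ((w + k) x) ∂μ) - (∫ x, G x (w x) ∂μ) - hG.derivative w k =
        ∫ x, remainder g G x (w x) (k x) * k x ∂μ := by
      have hd : Integrable (fun x => G x ((w + k) x) - G x (w x)) μ :=
        (hG.integrable_comp (Lp.memLp _)).sub (hG.integrable_comp (Lp.memLp _))
      rw [hG.derivative_apply, ← integral_sub (hG.integrable_comp (Lp.memLp _))
        (hG.integrable_comp (Lp.memLp _)),
        ← integral_sub hd (hG.integrable_deriv_mul (Lp.memLp _) (Lp.memLp _))]
      refine integral_congr_ae ?_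
      filter_upwards [Lp.coeFn_add w k] with x hx
      rw [remainder_mul, hx, Pi.add_apply]
    rw [h1]
    refine (norm_integral_le_integral_norm _).trans ?_
    simp_rw [norm_mul]
    refine (integral_mul_norm_le_Lp_mul_Lq hc (hG.memLp_remainder (Lp.memLp w) (Lp.memLp k))
      (Lp.memLp k)).trans (le_of_eq ?_)
    simp only [Real.norm_eq_abs]
    rw [norm_rpow_eq_integral hq, ← Real.rpow_mul (norm_nonneg _), mul_one_div_cancel (by linarith),
      Real.rpow_one]
  rw [hasFDerivAt_iff_isLittleO_nhds_zero, Asymptotics.isLittleO_iff]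
  intro ε hε
  have h2 := (hG.tendsto_integral_remainder w).rpow_const (p := 1 / (q / (q - 1)))
    (Or.inr (by have := hc.nonneg; positivity))
  rw [Real.zero_rpow (one_div_pos.2 hc.pos).ne'] at h2
  filter_upwards [h2.eventually (gt_mem_nhds hε)] with k hk
  exact (key k).trans (by gcongr)

/-- The derivatives of `w ↦ ∫ G(x, w x)` are uniformly bounded on bounded sets of `L^q`. -/
theorem exists_norm_derivative_le (hG : IsGrowthPotential μ q g G) (R : ℝ) :
    ∃ M : ℝ, ∀ w : Lp ℝ (ENNReal.ofReal q) μ, ‖w‖ ≤ R → ‖hG.derivative w‖ ≤ M := by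
  have hq := hG.one_lt
  have hc := hG.holderConjugate
  obtain ⟨C, hC, hg⟩ := hG.growth
  obtain ⟨D, hD, hpow⟩ := exists_rpow_growth_le hq hC
  refine ⟨(D * (μ.real Set.univ + max R 0 ^ q)) ^ (1 / (q / (q - 1))), fun w hw =>
    ContinuousLinearMap.opNorm_le_bound _ (by positivity) fun φ => ?_⟩
  rw [hG.derivative_apply]
  refine (norm_integral_le_integral_norm _).trans ?_
  simp_rw [norm_mul]
  refine (integral_mul_norm_le_Lp_mul_Lq hc (hG.memLp_deriv_comp (Lp.memLp w))
    (Lp.memLp φ)).trans ?_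
  simp only [Real.norm_eq_abs]
  rw [norm_rpow_eq_integral hq φ, ← Real.rpow_mul (norm_nonneg _), mul_one_div_cancel (by linarith),
    Real.rpow_one]
  have hi := ((integrable_const (μ := μ) (1 : ℝ)).add
    (integrable_abs_rpow hq (Lp.memLp w))).const_mul D
  have h1 : ∫ x, |g x (w x)| ^ (q / (q - 1)) ∂μ ≤ D * (μ.real Set.univ + max R 0 ^ q) := by
    calc ∫ x, |g x (w x)| ^ (q / (q - 1)) ∂μ ≤ ∫ x, D * (1 + |w x| ^ q) ∂μ := by
          refine integral_mono_of_nonneg (ae_of_all _ fun x => by positivity) hi ?_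
          filter_upwards [hg] with x hx
          have := hpow (w x) 0 (g x (w x)) (by simpa using hx (w x))
          simpa [Real.zero_rpow (by linarith : q ≠ 0)] using this
      _ = D * (μ.real Set.univ + ‖w‖ ^ q) := by
          rw [integral_const_mul, integral_add (integrable_const _)
            (integrable_abs_rpow hq (Lp.memLp w)), norm_rpow_eq_integral hq]
          simp
      _ ≤ _ := by
          gcongr
          exact hw.trans (le_max_left _ _)
  have h0 : 0 ≤ 1 / (q / (q - 1)) := (one_div_pos.2 hc.pos).le
  gcongr

end IsGrowthPotential

/-! ### Compactness of Cerami sequences for an abstract action functional -/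

/-- This holds also in the trivial space, where the supremum of the empty set is `0`. -/
theorem ContinuousLinearMap.opNorm_le_sSup_abs {E : Type*} [NormedAddCommGroup E]
    [NormedSpace ℝ E] (L : E →L[ℝ] ℝ) : ‖L‖ ≤ sSup {r : ℝ | ∃ φ : E, ‖φ‖ = 1 ∧ r = |L φ|} := by
  have hb : BddAbove {r : ℝ | ∃ φ : E, ‖φ‖ = 1 ∧ r = |L φ|} := by
    refine ⟨‖L‖, ?_⟩
    rintro _ ⟨φ, hφ, rfl⟩
    simpa [hφ] using L.le_opNorm φ
  refine L.opNorm_le_bound (Real.sSup_nonneg ?_) fun φ => ?_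
  · rintro _ ⟨φ, -, rfl⟩
    exact abs_nonneg _
  · rcases eq_or_ne φ 0 with rfl | hφ
    · simp
    · have hφ' : 0 < ‖φ‖ := norm_pos_iff.2 hφ
      have h1 := le_csSup hb ⟨‖φ‖⁻¹ • φ, by rw [norm_smul, norm_inv, norm_norm,
        inv_mul_cancel₀ hφ'.ne'], rfl⟩
      rw [map_smul, smul_eq_mul, abs_mul, abs_of_pos (inv_pos.2 hφ'), inv_mul_le_iff₀ hφ',
        mul_comm] at h1
      exact h1

namespace IsGrowthPotential

variable {α : Type*} [MeasurableSpace α] {μ : Measure α} {q : ℝ}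
  {g G : α → ℝ → ℝ} [Fact (1 ≤ ENNReal.ofReal q)]
  {H : Type*} [NormedAddCommGroup H] [InnerProductSpace ℝ H]

/-- The functional `u ↦ ½ ‖u‖² - ∫ G(x, (ι u) x)` on `H`, for an embedding `ι : H → L^q`. -/
noncomputable def action (ι : H →L[ℝ] Lp ℝ (ENNReal.ofReal q) μ) (G : α → ℝ → ℝ) (u : H) : ℝ :=
  1 / 2 * ‖u‖ ^ 2 - ∫ x, G x (ι u x) ∂μ

variable {ι : H →L[ℝ] Lp ℝ (ENNReal.ofReal q) μ}

theorem action_zero (hG : IsGrowthPotential μ q g G) : action ι G 0 = 0 := by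
  have h1 : ∫ x, G x (ι 0 x) ∂μ = 0 := by
    rw [← integral_zero α ℝ]
    refine integral_congr_ae ?_
    rw [map_zero]
    filter_upwards [Lp.coeFn_zero ℝ (ENNReal.ofReal q) μ] with x hx
    rw [hx]; exact hG.zero x
  rw [action, h1, norm_zero]
  simp

variable [IsFiniteMeasure μ]

/-- The derivative of `action ι G` at `u`. -/
noncomputable def actionDeriv (hG : IsGrowthPotential μ q g G)
    (ι : H →L[ℝ] Lp ℝ (ENNReal.ofReal q) μ) (u : H) : H →L[ℝ] ℝ :=
  innerSL ℝ u - (hG.derivative (ι u)).comp ι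

theorem actionDeriv_apply (hG : IsGrowthPotential μ q g G) (u φ : H) :
    hG.actionDeriv ι u φ = inner ℝ u φ - hG.derivative (ι u) (ι φ) := rfl

theorem hasFDerivAt_action (hG : IsGrowthPotential μ q g G) (u : H) :
    HasFDerivAt (action ι G) (hG.actionDeriv ι u) u := by
  have h1 : HasFDerivAt (fun v : H => 1 / 2 * ‖v‖ ^ 2) (innerSL ℝ u) u := by
    have := ((hasStrictFDerivAt_norm_sq u).hasFDerivAt).const_mul (1 / 2 : ℝ)
    rwa [← Nat.cast_smul_eq_nsmul ℝ, smul_smul, Nat.cast_ofNat, one_div_mul_cancel two_ne_zero,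
      one_smul] at this
  exact h1.sub ((hG.hasFDerivAt_integral (ι u)).comp u ι.hasFDerivAt)

theorem continuous_action (hG : IsGrowthPotential μ q g G) : Continuous (action ι G) :=
  continuous_iff_continuousAt.2 fun u => (hG.hasFDerivAt_action u).continuousAt

/-- On the ray through `u` the quadratic part of the action cancels in `J(u) - ½ J'(u) u`. -/
theorem action_sub_half_actionDeriv (hG : IsGrowthPotential μ q g G) (u : H) :
    action ι G u - 1 / 2 * hG.actionDeriv ι u u =
      ∫ x, (1 / 2 * ι u x * g x (ι u x) - G x (ι u x)) ∂μ := by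
  have h1 : ∫ x, (1 / 2 * ι u x * g x (ι u x) - G x (ι u x)) ∂μ =
      1 / 2 * ∫ x, g x (ι u x) * ι u x ∂μ - ∫ x, G x (ι u x) ∂μ := by
    rw [← integral_const_mul, ← integral_sub ((hG.integrable_deriv_mul (Lp.memLp _)
      (Lp.memLp _)).const_mul _) (hG.integrable_comp (Lp.memLp _))]
    refine integral_congr_ae (ae_of_all _ fun x => ?_)
    ring
  rw [h1, actionDeriv_apply, derivative_apply, action, real_inner_self_eq_norm_sq]
  ring

/-- The maximum of the action on the segment `[0, u]` is attained at an endpoint, or at an interior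
critical point, where the quasi-monotonicity of `½ t g - G` applies. -/
theorem action_smul_le (hG : IsGrowthPotential μ q g G) {γ : ℝ}
    (hγ : ∀ᵐ x ∂μ, ∀ t τ, 0 < τ → τ ≤ 1 →
      1 / 2 * (τ * t) * g x (τ * t) - G x (τ * t) ≤ γ * (1 / 2 * t * g x t - G x t))
    (u : H) {τ : ℝ} (hτ0 : 0 ≤ τ) (hτ1 : τ ≤ 1) :
    action ι G (τ • u) ≤
      max 0 (max (action ι G u) (γ * (action ι G u - 1 / 2 * hG.actionDeriv ι u u))) := by
  have hc : Continuous fun r : ℝ => action ι G (r • u) :=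
    hG.continuous_action.comp (continuous_id.smul continuous_const)
  obtain ⟨r, ⟨hr0, hr1⟩, hr⟩ := isCompact_Icc.exists_isMaxOn
    (Set.nonempty_Icc.2 (zero_le_one' ℝ)) hc.continuousOn
  refine (hr (Set.mem_Icc.2 ⟨hτ0, hτ1⟩)).trans ?_
  dsimp only
  rcases hr0.eq_or_lt with rfl | hr0
  · rw [zero_smul, hG.action_zero]
    exact le_max_left _ _
  rcases hr1.eq_or_lt with rfl | hr1
  · rw [one_smul]
    exact (le_max_left _ _).trans (le_max_right _ _)
  refine le_trans ?_ ((le_max_right _ _).trans (le_max_right _ _))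
  have hd : HasDerivAt (fun r : ℝ => action ι G (r • u)) (hG.actionDeriv ι (r • u) u) r := by
    have h1 : HasDerivAt (fun r : ℝ => r • u) u r := by
      simpa using (hasDerivAt_id r).smul_const u
    exact (hG.hasFDerivAt_action (r • u)).comp_hasDerivAt r h1
  have h0 : hG.actionDeriv ι (r • u) u = 0 :=
    (hr.isLocalMax (Icc_mem_nhds hr0 hr1)).hasDerivAt_eq_zero hd
  have h2 := hG.action_sub_half_actionDeriv (ι := ι) (r • u)
  rw [map_smul (hG.actionDeriv ι (r • u)), h0, smul_zero, mul_zero, sub_zero] at h2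
  rw [h2, action_sub_half_actionDeriv, ← integral_const_mul]
  have hint : ∀ v : H, Integrable (fun x => 1 / 2 * ι v x * g x (ι v x) - G x (ι v x)) μ :=
    fun v => (((hG.integrable_deriv_mul (Lp.memLp (ι v)) (Lp.memLp (ι v))).const_mul
      (1 / 2)).congr (ae_of_all _ fun x => by dsimp only; ring)).sub
      (hG.integrable_comp (Lp.memLp (ι v)))
  refine integral_mono_ae (hint _) ((hint u).const_mul γ) ?_
  rw [map_smul ι r u]
  filter_upwards [hγ, Lp.coeFn_smul r (ι u)] with x hx hs
  rw [hs]
  exact hx (ι u x) r hr0 hr1.le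

/-- A bounded sequence along which the derivative of the action tends to zero has a strongly
convergent subsequence: in the identity
`‖u - v‖² = (J'(u) - J'(v)) (u - v) + (D(ι u) - D(ι v)) (ι (u - v))` the last term is controlled by
compactness of `ι`. -/
theorem exists_subseq_tendsto_of_bounded [CompleteSpace H] (hG : IsGrowthPotential μ q g G)
    (hι : ∀ u : ℕ → H, (∃ R, ∀ j, ‖u j‖ ≤ R) →
      ∃ k : ℕ → ℕ, StrictMono k ∧ ∃ v, Tendsto (fun j => ι (u (k j))) atTop (𝓝 v))
    {u : ℕ → H} {R : ℝ} (hR : ∀ j, ‖u j‖ ≤ R)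
    (hd : Tendsto (fun j => ‖hG.actionDeriv ι (u j)‖) atTop (𝓝 0)) :
    ∃ k : ℕ → ℕ, StrictMono k ∧ ∃ v, Tendsto (fun j => u (k j)) atTop (𝓝 v) := by
  obtain ⟨k, hk, w, hw⟩ := hι u ⟨R, hR⟩
  refine ⟨k, hk, cauchySeq_tendsto_of_complete ?_⟩
  obtain ⟨M, hM⟩ := hG.exists_norm_derivative_le (‖ι‖ * R)
  have hM' : ∀ j, ‖hG.derivative (ι (u j))‖ ≤ M := fun j =>
    hM _ ((ι.le_opNorm _).trans (by gcongr; exact hR j))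
  rw [cauchySeq_iff_tendsto_dist_atTop_0]
  have hι2 := cauchySeq_iff_tendsto_dist_atTop_0.1 hw.cauchySeq
  have hd1 : Tendsto (fun p : ℕ × ℕ => ‖hG.actionDeriv ι (u (k p.1))‖) atTop (𝓝 0) :=
    (hd.comp hk.tendsto_atTop).comp (tendsto_fst.mono_left prod_atTop_atTop_eq.ge)
  have hd2 : Tendsto (fun p : ℕ × ℕ => ‖hG.actionDeriv ι (u (k p.2))‖) atTop (𝓝 0) :=
    (hd.comp hk.tendsto_atTop).comp (tendsto_snd.mono_left prod_atTop_atTop_eq.ge)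
  have hb := ((hd1.add hd2).mul_const (2 * R)).add (hι2.const_mul (2 * M))
  simp only [add_zero, zero_mul, mul_zero] at hb
  have hsq : Tendsto (fun p : ℕ × ℕ => dist (u (k p.1)) (u (k p.2)) ^ 2) atTop (𝓝 0) := by
    refine squeeze_zero (fun p => sq_nonneg _) (fun p => ?_) hb
    set a := u (k p.1) with ha
    set b := u (k p.2) with hb
    have h1 : ‖a - b‖ ^ 2 = (hG.actionDeriv ι a (a - b) - hG.actionDeriv ι b (a - b)) +
        (hG.derivative (ι a) (ι (a - b)) - hG.derivative (ι b) (ι (a - b))) := by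
      rw [actionDeriv_apply, actionDeriv_apply, ← real_inner_self_eq_norm_sq, inner_sub_left]
      ring
    have hab : ‖a - b‖ ≤ 2 * R := (norm_sub_le a b).trans (by linarith [hR (k p.1), hR (k p.2)])
    have h2 : ∀ L : H →L[ℝ] ℝ, |L (a - b)| ≤ ‖L‖ * (2 * R) := fun L =>
      (L.le_opNorm _).trans (by gcongr)
    have h3 : ∀ j, |hG.derivative (ι (u j)) (ι (a - b))| ≤ M * dist (ι a) (ι b) := fun j => by
      refine ((hG.derivative _).le_opNorm _).trans ?_
      rw [dist_eq_norm, ← map_sub]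
      gcongr
      exact hM' j
    rw [dist_eq_norm, h1]
    have := abs_le.1 (h2 (hG.actionDeriv ι a))
    have := abs_le.1 (h2 (hG.actionDeriv ι b))
    have := abs_le.1 (h3 (k p.1))
    have := abs_le.1 (h3 (k p.2))
    rw [← ha, ← hb] at *
    linarith
  have h4 := hsq.sqrt
  simpa [Real.sqrt_sq dist_nonneg] using h4

/-- Along a sequence with `‖u j‖ → ∞` and bounded action, a limit of the normalized sequence
vanishes if the potential is superquadratic. -/
theorem eq_zero_of_tendsto_normalized (hG : IsGrowthPotential μ q g G) (hq : 2 ≤ q)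
    (hsq : ∀ M : ℝ, ∃ D : ℝ, ∀ᵐ x ∂μ, ∀ t, M * t ^ 2 - D ≤ G x t)
    {u : ℕ → H} (hu : Tendsto (fun j => ‖u j‖) atTop atTop) {c : ℝ}
    (hc : Tendsto (fun j => action ι G (u j)) atTop (𝓝 c))
    {v : Lp ℝ (ENNReal.ofReal q) μ}
    (hv : Tendsto (fun j => ι (‖u j‖⁻¹ • u j)) atTop (𝓝 v)) : v = 0 := by
  have hS := sq_isGrowthPotential (μ := μ) hq
  have hcont : Continuous fun w : Lp ℝ (ENNReal.ofReal q) μ => ∫ x, w x ^ 2 ∂μ :=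
    continuous_iff_continuousAt.2 fun w => (hS.hasFDerivAt_integral w).continuousAt
  have hlim := (hcont.tendsto v).comp hv
  have hinv : Tendsto (fun j => (‖u j‖ ^ 2)⁻¹) atTop (𝓝 0) :=
    tendsto_inv_atTop_zero.comp ((tendsto_pow_atTop two_ne_zero).comp hu)
  have key : ∀ M : ℝ, M * ∫ x, v x ^ 2 ∂μ ≤ 1 / 2 := by
    intro M
    obtain ⟨D, hD⟩ := hsq M
    have h1 : Tendsto (fun j => 1 / 2 + (D * μ.real Set.univ - action ι G (u j)) * (‖u j‖ ^ 2)⁻¹)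
        atTop (𝓝 (1 / 2 + (D * μ.real Set.univ - c) * 0)) :=
      ((hc.const_sub _).mul hinv).const_add _
    rw [mul_zero, add_zero] at h1
    refine le_of_tendsto_of_tendsto (hlim.const_mul M) h1 ?_
    filter_upwards [hu.eventually_gt_atTop 0] with j hj
    have h2 : ∫ x, (ι (‖u j‖⁻¹ • u j)) x ^ 2 ∂μ = (‖u j‖ ^ 2)⁻¹ * ∫ x, (ι (u j)) x ^ 2 ∂μ := by
      rw [← integral_const_mul, map_smul]
      refine integral_congr_ae ?_
      filter_upwards [Lp.coeFn_smul ‖u j‖⁻¹ (ι (u j))] with x hx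
      rw [hx, Pi.smul_apply, smul_eq_mul, mul_pow, inv_pow]
    have hi := hS.integrable_comp (Lp.memLp (ι (u j)))
    have h3 : M * ∫ x, (ι (u j)) x ^ 2 ∂μ - D * μ.real Set.univ ≤ ∫ x, G x (ι (u j) x) ∂μ := by
      have h4 : ∫ x, (M * (ι (u j)) x ^ 2 - D) ∂μ =
          M * ∫ x, (ι (u j)) x ^ 2 ∂μ - D * μ.real Set.univ := by
        rw [integral_sub (hi.const_mul M) (integrable_const D), integral_const_mul, integral_const,
          smul_eq_mul, mul_comm D]
      rw [← h4]
      refine integral_mono_ae ((hi.const_mul M).sub (integrable_const D))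
        (hG.integrable_comp (Lp.memLp _)) ?_
      filter_upwards [hD] with x hx using hx _
    have h5 : ∫ x, G x (ι (u j) x) ∂μ = 1 / 2 * ‖u j‖ ^ 2 - action ι G (u j) := by
      rw [action]; ring
    rw [h5] at h3
    have h6 : (M * ∫ x, (ι (u j)) x ^ 2 ∂μ) ≤
        1 / 2 * ‖u j‖ ^ 2 + (D * μ.real Set.univ - action ι G (u j)) := by linarith
    have h7 : 0 < ‖u j‖ ^ 2 := by positivity
    change M * ∫ x, (ι (‖u j‖⁻¹ • u j)) x ^ 2 ∂μ ≤ _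
    rw [h2]
    have h8 := mul_le_mul_of_nonneg_left h6 (inv_pos.2 h7).le
    have h9 : (‖u j‖ ^ 2)⁻¹ * ‖u j‖ ^ 2 = 1 := inv_mul_cancel₀ h7.ne'
    linear_combination h8 + 1 / 2 * h9
  have h0 : ∫ x, v x ^ 2 ∂μ = 0 := by
    refine le_antisymm ?_ (integral_nonneg fun x => sq_nonneg _)
    by_contra! hpos
    have := key (∫ x, v x ^ 2 ∂μ)⁻¹
    rw [inv_mul_cancel₀ hpos.ne'] at this
    norm_num at this
  rw [integral_eq_zero_iff_of_nonneg (fun x => sq_nonneg _)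
    (hS.integrable_comp (Lp.memLp v))] at h0
  refine Lp.ext ?_
  filter_upwards [h0, Lp.coeFn_zero ℝ (ENNReal.ofReal q) μ] with x hx h0x
  rw [h0x]
  simpa using hx

/-- The norms of a Cerami sequence do not tend to infinity. -/
theorem not_tendsto_norm_atTop (hG : IsGrowthPotential μ q g G) (hq : 2 ≤ q)
    (hι : ∀ u : ℕ → H, (∃ R, ∀ j, ‖u j‖ ≤ R) →
      ∃ k : ℕ → ℕ, StrictMono k ∧ ∃ v, Tendsto (fun j => ι (u (k j))) atTop (𝓝 v))
    (hsq : ∀ M : ℝ, ∃ D : ℝ, ∀ᵐ x ∂μ, ∀ t, M * t ^ 2 - D ≤ G x t) {γ : ℝ}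
    (hγ : ∀ᵐ x ∂μ, ∀ t τ, 0 < τ → τ ≤ 1 →
      1 / 2 * (τ * t) * g x (τ * t) - G x (τ * t) ≤ γ * (1 / 2 * t * g x t - G x t))
    {u : ℕ → H} {c : ℝ} (hc : Tendsto (fun j => action ι G (u j)) atTop (𝓝 c))
    (hd : Tendsto (fun j => (1 + ‖u j‖) * ‖hG.actionDeriv ι (u j)‖) atTop (𝓝 0)) :
    ¬Tendsto (fun j => ‖u j‖) atTop atTop := by
  intro hu
  obtain ⟨k, hk, v, hv⟩ := hι (fun j => ‖u j‖⁻¹ • u j) ⟨1, fun j => by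
    rw [norm_smul, norm_inv, norm_norm]
    exact inv_mul_le_one⟩
  have hu' := hu.comp hk.tendsto_atTop
  have hc' := hc.comp hk.tendsto_atTop
  have hd' := hd.comp hk.tendsto_atTop
  obtain rfl := hG.eq_zero_of_tendsto_normalized hq hsq hu' hc' hv
  have hd2 : Tendsto (fun j => hG.actionDeriv ι (u (k j)) (u (k j))) atTop (𝓝 0) := by
    refine squeeze_zero_norm (fun j => ?_) hd'
    refine ((hG.actionDeriv ι _).le_opNorm _).trans ?_
    dsimp only [Function.comp_apply]
    nlinarith [norm_nonneg (hG.actionDeriv ι (u (k j)))]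
  have hbound : Tendsto (fun j => max 0 (max (action ι G (u (k j))) (γ * (action ι G (u (k j)) -
      1 / 2 * hG.actionDeriv ι (u (k j)) (u (k j)))))) atTop
      (𝓝 (max 0 (max c (γ * (c - 1 / 2 * 0))))) :=
    tendsto_const_nhds.max (hc'.max ((hc'.sub (hd2.const_mul _)).const_mul γ))
  set B := max 0 (max c (γ * (c - 1 / 2 * 0))) with hB
  have hB0 : 0 ≤ B := le_max_left _ _
  have hcont : Continuous fun w : Lp ℝ (ENNReal.ofReal q) μ => ∫ x, G x (w x) ∂μ :=
    continuous_iff_continuousAt.2 fun w => (hG.hasFDerivAt_integral w).continuousAt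
  -- The points `R • u / ‖u‖` lie on the segments `[0, u]`, and their actions tend to `R ^ 2 / 2`.
  have key : ∀ R : ℝ, 0 < R → 1 / 2 * R ^ 2 ≤ B := by
    intro R hR
    have h1 : Tendsto (fun j => 1 / 2 * R ^ 2 -
        ∫ x, G x ((R • ι (‖u (k j)‖⁻¹ • u (k j))) x) ∂μ) atTop (𝓝 (1 / 2 * R ^ 2 - 0)) := by
      refine Tendsto.const_sub _ ?_
      have h2 := (hcont.tendsto _).comp (hv.const_smul R)
      have h3 := hG.action_zero (ι := ι)
      rw [action, map_zero, norm_zero] at h3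
      have h4 : ∫ x, G x ((R • (0 : Lp ℝ (ENNReal.ofReal q) μ)) x) ∂μ = 0 := by
        rw [smul_zero]; simpa using h3
      rwa [h4] at h2
    rw [sub_zero] at h1
    refine le_of_tendsto_of_tendsto h1 hbound ?_
    filter_upwards [hu'.eventually_ge_atTop R] with j hj
    have hj' : R ≤ ‖u (k j)‖ := hj
    have hpos : 0 < ‖u (k j)‖ := hR.trans_le hj'
    have h5 : (R / ‖u (k j)‖) • u (k j) = R • (‖u (k j)‖⁻¹ • u (k j)) := by
      rw [smul_smul, div_eq_mul_inv]
    have h6 := hG.action_smul_le (ι := ι) hγ (u (k j)) (τ := R / ‖u (k j)‖) (by positivity)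
      ((div_le_one hpos).2 hj')
    refine le_trans (le_of_eq ?_) h6
    rw [h5, action, map_smul ι R, norm_smul, norm_smul, norm_inv, norm_norm,
      inv_mul_cancel₀ hpos.ne', mul_one, Real.norm_of_nonneg hR.le]
  have := key (2 * (B + 1)) (by positivity)
  nlinarith

theorem ceramiCondition_action [CompleteSpace H] (hG : IsGrowthPotential μ q g G) (hq : 2 ≤ q)
    (hι : ∀ u : ℕ → H, (∃ R, ∀ j, ‖u j‖ ≤ R) →
      ∃ k : ℕ → ℕ, StrictMono k ∧ ∃ v, Tendsto (fun j => ι (u (k j))) atTop (𝓝 v))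
    (hsq : ∀ M : ℝ, ∃ D : ℝ, ∀ᵐ x ∂μ, ∀ t, M * t ^ 2 - D ≤ G x t) {γ : ℝ}
    (hγ : ∀ᵐ x ∂μ, ∀ t τ, 0 < τ → τ ≤ 1 →
      1 / 2 * (τ * t) * g x (τ * t) - G x (τ * t) ≤ γ * (1 / 2 * t * g x t - G x t)) (c : ℝ) :
    CeramiCondition (action ι G) c := by
  intro u hc hs
  simp only [fun v => (hG.hasFDerivAt_action (ι := ι) v).fderiv] at hs
  have hd : Tendsto (fun j => (1 + ‖u j‖) * ‖hG.actionDeriv ι (u j)‖) atTop (𝓝 0) := by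
    refine squeeze_zero (fun j => by positivity) (fun j => ?_) hs
    gcongr
    exact (hG.actionDeriv ι (u j)).opNorm_le_sSup_abs
  have hd0 : Tendsto (fun j => ‖hG.actionDeriv ι (u j)‖) atTop (𝓝 0) := by
    refine squeeze_zero (fun j => by positivity) (fun j => ?_) hd
    nlinarith [norm_nonneg (u j), norm_nonneg (hG.actionDeriv ι (u j))]
  have hnot := hG.not_tendsto_norm_atTop hq hι hsq hγ hc hd
  rw [tendsto_atTop] at hnot
  push Not at hnot
  obtain ⟨R, hR⟩ := hnot
  obtain ⟨k, hk, hkR⟩ := extraction_of_frequently_atTop (P := fun j => ‖u j‖ ≤ R)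
    (hR.mono fun j hj => hj.le)
  obtain ⟨m, hm, v, hv⟩ := hG.exists_subseq_tendsto_of_bounded (u := u ∘ k) hι hkR
    (hd0.comp hk.tendsto_atTop)
  exact ⟨k ∘ m, hk.comp hm, v, hv⟩

end IsGrowthPotential

/-! ### Superlevel sets and subcritical integrability in `X₀` -/

namespace NonlocalSetting

variable {n : ℕ} {s : ℝ} {Ω : Set (EuclideanSpace ℝ (Fin n))} {K : EuclideanSpace ℝ (Fin n) → ℝ}

theorem dim_pos (h : NonlocalSetting s Ω K) : 0 < n := by
  have h1 := h.s_pos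
  have h2 := h.two_s_lt
  have h3 : (0 : ℝ) < n := by linarith
  exact_mod_cast h3

theorem measure_lt_top (h : NonlocalSetting s Ω K) : volume Ω < ⊤ := h.isBounded.measure_lt_top

theorem isFiniteMeasure_restrict (h : NonlocalSetting s Ω K) :
    IsFiniteMeasure (volume.restrict Ω) := ⟨by simpa using h.measure_lt_top⟩

variable {h : NonlocalSetting s Ω K}

theorem X0.measurable (u : h.X0) : Measurable (u : EuclideanSpace ℝ (Fin n) → ℝ) :=
  (AEEqFun.stronglyMeasurable u.1).measurable

theorem X0.norm_sq_eq (u : h.X0) : ‖u‖ ^ 2 =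
    ∫ p : EuclideanSpace ℝ (Fin n) × EuclideanSpace ℝ (Fin n),
      (u p.1 - u p.2) * (u p.1 - u p.2) * K (p.1 - p.2) :=
  (real_inner_self_eq_norm_sq u).symm

theorem mul_kernel_nonneg (h : NonlocalSetting s Ω K) (w : EuclideanSpace ℝ (Fin n) → ℝ)
    (x y : EuclideanSpace ℝ (Fin n)) : 0 ≤ (w x - w y) * (w x - w y) * K (x - y) := by
  by_cases hp : x = y
  · simp [hp]
  · exact mul_nonneg (mul_self_nonneg _) (h.kernel_pos _ (sub_ne_zero.2 hp)).le

theorem X0.lintegral_lintegral_eq (u : h.X0) :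
    ∫⁻ x, ∫⁻ y, ENNReal.ofReal ((u x - u y) * (u x - u y) * K (x - y)) =
      ENNReal.ofReal (‖u‖ ^ 2) := by
  rw [X0.norm_sq_eq, ofReal_integral_eq_lintegral_ofReal (X0.integrable u u)
    (ae_of_all _ fun p => h.mul_kernel_nonneg _ _ _), Measure.volume_eq_prod, lintegral_prod]
  exact (X0.integrable u u).1.aemeasurable.ennreal_ofReal

/-- Near the diagonal the kernel dominates its value at distance `r`. -/
theorem le_mul_kernel (h : NonlocalSetting s Ω K) {θ : ℝ} (hθ : 0 < θ)
    (hK : ∀ x, x ≠ 0 → θ * ‖x‖ ^ (-((n : ℝ) + 2 * s)) ≤ K x) (w : EuclideanSpace ℝ (Fin n) → ℝ)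
    {x y : EuclideanSpace ℝ (Fin n)} {r : ℝ} (hxy : y ∈ Metric.ball x r) :
    (w x - w y) * (w x - w y) * (θ * r ^ (-((n : ℝ) + 2 * s))) ≤
      (w x - w y) * (w x - w y) * K (x - y) := by
  by_cases hp : x = y
  · simp [hp]
  · have h1 : 0 < ‖x - y‖ := norm_pos_iff.2 (sub_ne_zero.2 hp)
    have h2 : ‖x - y‖ ≤ r := by
      rw [Metric.mem_ball, dist_comm, dist_eq_norm] at hxy
      exact hxy.le
    have h3 : -((n : ℝ) + 2 * s) ≤ 0 := by
      have := h.s_pos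
      have : (0 : ℝ) ≤ n := n.cast_nonneg
      linarith
    refine mul_le_mul_of_nonneg_left ?_ (mul_self_nonneg _)
    refine le_trans ?_ (hK _ (sub_ne_zero.2 hp))
    exact mul_le_mul_of_nonneg_left (Real.rpow_le_rpow_of_nonpos h1 h2 h3) hθ.le

theorem X0.measure_superlevel_le (u : h.X0) {t : ℝ} (ht : 0 < t) :
    volume {x | t < |u x|} ≤ volume Ω := by
  refine measure_mono_ae ?_
  filter_upwards [u.ae_eq_zero] with x hx htx
  by_contra hxΩ
  have htx' : t < |u x| := htx
  rw [hx hxΩ, abs_zero] at htx'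
  linarith

theorem unitBall_pos : 0 < volume.real (Metric.ball (0 : EuclideanSpace ℝ (Fin n)) 1) :=
  ENNReal.toReal_pos (Metric.measure_ball_pos _ _ one_pos).ne' measure_ball_lt_top.ne

theorem volume_ball_eq (x : EuclideanSpace ℝ (Fin n)) {r : ℝ} (hr : 0 < r) :
    volume (Metric.ball x r) = ENNReal.ofReal
      (r ^ n * volume.real (Metric.ball (0 : EuclideanSpace ℝ (Fin n)) 1)) := by
  rw [Measure.addHaar_ball_of_pos _ _ hr, finrank_euclideanSpace_fin,
    ENNReal.ofReal_mul (by positivity), ofReal_measureReal measure_ball_lt_top.ne]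

/-- Superlevel sets at heights `t` and `2 t`: around a point where `|u| > 2 t`, the ball of volume
`2 |{|u| > t}|` contains at least as much mass of `{|u| ≤ t}` as `{|u| > t}` has, and there the
difference `|u x - u y|` is at least `t`. -/
theorem exists_measure_superlevel_le (h : NonlocalSetting s Ω K) :
    ∃ C : ℝ, 0 < C ∧ ∀ (u : h.X0) (t : ℝ), 0 < t →
      volume.real {x | 2 * t < |u x|} ≤
        C * ‖u‖ ^ 2 * t ^ (-2 : ℝ) * volume.real {x | t < |u x|} ^ (2 * s / n) := by
  obtain ⟨θ, hθ, hK⟩ := h.kernel_lower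
  set ω := volume.real (Metric.ball (0 : EuclideanSpace ℝ (Fin n)) 1) with hω
  have hω0 : 0 < ω := unitBall_pos
  have hn : (0 : ℝ) < n := by exact_mod_cast h.dim_pos
  have hs := h.s_pos
  refine ⟨(2 / ω) ^ (1 + 2 * s / n) / θ, by positivity, fun u t ht => ?_⟩
  set A := {x | t < |u x|} with hA
  have hAm : MeasurableSet A := measurableSet_lt measurable_const u.measurable.abs
  have hAfin : volume A ≠ ⊤ := ((u.measure_superlevel_le ht).trans_lt h.measure_lt_top).ne
  set a := volume.real A with ha
  set b := volume.real {x | 2 * t < |u x|} with hb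
  have hsub : {x | 2 * t < |u x|} ⊆ A := fun x hx => by
    have hx' : 2 * t < |u x| := hx
    change t < |u x|
    linarith
  have hba : b ≤ a := measureReal_mono hsub hAfin
  have hb0 : 0 ≤ b := measureReal_nonneg
  rcases (measureReal_nonneg (μ := volume) (s := A)).eq_or_lt with ha0 | ha0
  · have : b ≤ 0 := by rw [ha] at hba; rw [ha0]; exact hba
    refine this.trans (by positivity)
  change 0 < a at ha0
  -- The radius for which balls have volume `2 * a`.
  set r := (2 * a / ω) ^ (1 / (n : ℝ)) with hr
  have hr0 : 0 < r := by positivity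
  have hrn : r ^ n * ω = 2 * a := by
    rw [hr, ← Real.rpow_natCast, ← Real.rpow_mul (by positivity), one_div_mul_cancel hn.ne',
      Real.rpow_one, div_mul_cancel₀ _ hω0.ne']
  set κ := t * t * (θ * r ^ (-((n : ℝ) + 2 * s))) with hκ
  have hκ0 : 0 ≤ κ := by positivity
  have h1 : ∀ x ∈ {x | 2 * t < |u x|}, ENNReal.ofReal (κ * a) ≤
      ∫⁻ y, ENNReal.ofReal ((u x - u y) * (u x - u y) * K (x - y)) := by
    intro x hx
    have hx' : 2 * t < |u x| := hx
    have hvol : ENNReal.ofReal a ≤ volume (Metric.ball x r \ A) := by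
      have h2 : volume (Metric.ball x r) - volume A ≤ volume (Metric.ball x r \ A) :=
        le_measure_sdiff
      rw [volume_ball_eq x hr0, hrn, ← ofReal_measureReal hAfin,
        ← ENNReal.ofReal_sub _ ha0.le] at h2
      convert h2 using 2
      ring
    calc ENNReal.ofReal (κ * a) = ENNReal.ofReal κ * ENNReal.ofReal a := ENNReal.ofReal_mul hκ0
      _ ≤ ENNReal.ofReal κ * volume (Metric.ball x r \ A) := by gcongr
      _ = ∫⁻ _ in Metric.ball x r \ A, ENNReal.ofReal κ := by rw [setLIntegral_const]
      _ ≤ ∫⁻ y in Metric.ball x r \ A,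
            ENNReal.ofReal ((u x - u y) * (u x - u y) * K (x - y)) := by
          refine setLIntegral_mono' (measurableSet_ball.diff hAm) fun y hy => ?_
          refine ENNReal.ofReal_le_ofReal (le_trans ?_ (h.le_mul_kernel hθ hK u hy.1))
          have hy2 : |u y| ≤ t := not_lt.1 hy.2
          have h3 : t ≤ |u x - u y| := by
            have := abs_sub_abs_le_abs_sub (u x) (u y)
            linarith
          rw [hκ, ← abs_mul_abs_self (u x - u y)]
          gcongr
      _ ≤ _ := setLIntegral_le_lintegral _ _
  have h2 : ENNReal.ofReal (κ * a * b) ≤ ENNReal.ofReal (‖u‖ ^ 2) := by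
    rw [← u.lintegral_lintegral_eq, ENNReal.ofReal_mul (by positivity), hb,
      ofReal_measureReal (measure_ne_top_of_subset hsub hAfin), ← setLIntegral_const]
    exact (setLIntegral_mono' (measurableSet_lt measurable_const u.measurable.abs) h1).trans
      (setLIntegral_le_lintegral _ _)
  rw [ENNReal.ofReal_le_ofReal_iff (sq_nonneg _)] at h2
  have h3 : r ^ (-((n : ℝ) + 2 * s)) * a = ((2 / ω) ^ (1 + 2 * s / n))⁻¹ * (a ^ (2 * s / n))⁻¹ := by
    rw [hr, ← Real.rpow_mul (by positivity), mul_div_right_comm,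
      Real.mul_rpow (by positivity) ha0.le,
      show 1 / (n : ℝ) * -(n + 2 * s) = -(1 + 2 * s / n) by field_simp,
      Real.rpow_neg (by positivity), Real.rpow_neg ha0.le, Real.rpow_add ha0, Real.rpow_one]
    field_simp
  have h4 : κ * a * b = t ^ 2 * θ * b * (((2 / ω) ^ (1 + 2 * s / n))⁻¹ * (a ^ (2 * s / n))⁻¹) := by
    rw [← h3, hκ]; ring
  rw [h4, ← mul_inv, ← div_eq_mul_inv, div_le_iff₀ (by positivity)] at h2
  rw [Real.rpow_neg ht.le, Real.rpow_two]
  have h5 : (2 / ω) ^ (1 + 2 * s / n) / θ * ‖u‖ ^ 2 * (t ^ 2)⁻¹ * a ^ (2 * s / n) =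
      ‖u‖ ^ 2 * ((2 / ω) ^ (1 + 2 * s / n) * a ^ (2 * s / n)) / (t ^ 2 * θ) := by
    field_simp
  rw [h5, le_div_iff₀ (by positivity)]
  linarith

/-- The critical Sobolev exponent. -/
noncomputable def criticalExponent (n : ℕ) (s : ℝ) : ℝ := 2 * n / (n - 2 * s)

/-- Iteration of the superlevel estimate over dyadic heights gives weak integrability to the
critical exponent. -/
theorem exists_measure_dyadic_le (h : NonlocalSetting s Ω K) :
    ∃ B : ℝ, 0 ≤ B ∧ ∀ u : h.X0, ‖u‖ ≤ 1 → ∀ k : ℕ,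
      volume.real {x | 2 ^ k < |u x|} ≤ B * ((2 : ℝ) ^ (-criticalExponent n s)) ^ k := by
  obtain ⟨C, hC, hCu⟩ := h.exists_measure_superlevel_le
  have hn : (0 : ℝ) < n := by exact_mod_cast h.dim_pos
  have hs := h.s_pos
  have h2s := h.two_s_lt
  set β := 2 * s / n with hβ
  have hβ0 : 0 < β := by positivity
  have hβ1 : β < 1 := by rw [hβ, div_lt_one hn]; exact h2s
  set p := criticalExponent n s with hp
  have hpβ : p = 2 + β * p := by
    have : (n : ℝ) - 2 * s ≠ 0 := by linarith
    rw [hp, criticalExponent, hβ]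
    field_simp
    ring
  set D := C * 2 ^ p with hD
  have hD0 : 0 < D := by positivity
  -- The recursion reads `b (k + 1) ≤ D * b k ^ β` for `b k = 2 ^ (k * p) * |{|u| > 2 ^ k}|`; since
  -- `β < 1`, it preserves the bound `b ≤ B` as soon as `D * B ^ β ≤ B`.
  set B := max (volume.real Ω) (D ^ (1 / (1 - β))) with hB
  have hB0 : 0 < B := lt_of_lt_of_le (by positivity) (le_max_right _ _)
  have hDB : D * B ^ β ≤ B := by
    have h1 : D ≤ B ^ (1 - β) := by
      have := Real.rpow_le_rpow (by positivity) (le_max_right (volume.real Ω) (D ^ (1 / (1 - β))))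
        (by linarith : 0 ≤ 1 - β)
      rwa [← Real.rpow_mul hD0.le, one_div_mul_cancel (by linarith), Real.rpow_one] at this
    calc D * B ^ β ≤ B ^ (1 - β) * B ^ β := by gcongr
      _ = B := by rw [← Real.rpow_add hB0, sub_add_cancel, Real.rpow_one]
  refine ⟨B, hB0.le, fun u hu k => ?_⟩
  induction k with
  | zero =>
    rw [pow_zero, pow_zero, mul_one]
    exact (ENNReal.toReal_mono h.measure_lt_top.ne
      (u.measure_superlevel_le one_pos)).trans (le_max_left _ _)
  | succ k ih =>
    have h1 := hCu u (2 ^ k) (by positivity)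
    rw [← pow_succ'] at h1
    refine h1.trans ?_
    have h2 : ‖u‖ ^ 2 ≤ 1 := pow_le_one₀ (norm_nonneg _) hu
    have h3 : ((2 : ℝ) ^ k) ^ (-2 : ℝ) * (((2 : ℝ) ^ (-p)) ^ k) ^ β = ((2 : ℝ) ^ (-p)) ^ k := by
      rw [← Real.rpow_natCast ((2 : ℝ) ^ (-p)) k, ← Real.rpow_natCast 2 k,
        ← Real.rpow_mul zero_le_two, ← Real.rpow_mul zero_le_two,
        ← Real.rpow_mul zero_le_two, ← Real.rpow_add zero_lt_two]
      congr 1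
      linear_combination (k : ℝ) * hpβ
    calc C * ‖u‖ ^ 2 * ((2 : ℝ) ^ k) ^ (-2 : ℝ) * volume.real {x | 2 ^ k < |u x|} ^ β
        ≤ C * 1 * ((2 : ℝ) ^ k) ^ (-2 : ℝ) * (B * ((2 : ℝ) ^ (-p)) ^ k) ^ β := by
          gcongr
      _ = C * B ^ β * (((2 : ℝ) ^ k) ^ (-2 : ℝ) * (((2 : ℝ) ^ (-p)) ^ k) ^ β) := by
          rw [Real.mul_rpow hB0.le (by positivity)]; ring
      _ = D * B ^ β * ((2 : ℝ) ^ (-p)) ^ (k + 1) := by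
          rw [h3, hD, pow_succ, Real.rpow_neg (by norm_num)]
          field_simp
      _ ≤ _ := by gcongr

/-- Subcritical integrability, uniform on the unit ball of `X₀`. -/
theorem exists_lintegral_rpow_le (h : NonlocalSetting s Ω K) {q : ℝ} (hq0 : 0 < q)
    (hq : q < criticalExponent n s) :
    ∃ C : ENNReal, C ≠ ⊤ ∧ ∀ u : h.X0, ‖u‖ ≤ 1 →
      ∫⁻ x in Ω, ENNReal.ofReal (|u x| ^ q) ≤ C := by
  obtain ⟨B, hB0, hB⟩ := h.exists_measure_dyadic_le
  set p := criticalExponent n s with hp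
  set ρ : ℝ := 2 ^ (q - p) with hρ
  have hρ0 : 0 < ρ := by positivity
  have hρ1 : ρ < 1 := Real.rpow_lt_one_of_one_lt_of_neg (by norm_num) (by linarith)
  have hsum : Summable fun k : ℕ => 2 ^ q * B * ρ ^ k :=
    (summable_geometric_of_lt_one hρ0.le hρ1).mul_left _
  refine ⟨volume Ω + ENNReal.ofReal (∑' k : ℕ, 2 ^ q * B * ρ ^ k),
    ENNReal.add_ne_top.2 ⟨h.measure_lt_top.ne, ENNReal.ofReal_ne_top⟩, fun u hu => ?_⟩
  have hmeas : ∀ k : ℕ, MeasurableSet {x | 2 ^ k < |u x|} := fun k =>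
    measurableSet_lt measurable_const u.measurable.abs
  have hpt : ∀ x, ENNReal.ofReal (|u x| ^ q) ≤
      1 + ∑' k : ℕ, {x | 2 ^ k < |u x|}.indicator
        (fun _ => ENNReal.ofReal (((2 : ℝ) ^ (k + 1)) ^ q)) x := by
    intro x
    rcases le_or_gt |u x| 1 with hx | hx
    · refine le_add_right ?_
      rw [← ENNReal.ofReal_one]
      exact ENNReal.ofReal_le_ofReal (Real.rpow_le_one (abs_nonneg _) hx hq0.le)
    · obtain ⟨m, hm1, hm2⟩ := exists_mem_Ioc_zpow (zero_lt_one.trans hx) (one_lt_two (α := ℝ))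
      have hm0 : 0 < m + 1 := by
        by_contra! hm
        exact absurd (hx.trans_le (hm2.trans (zpow_le_one_of_nonpos₀ one_le_two hm)))
          (lt_irrefl _)
      lift m to ℕ using by omega
      have hk1 : (2 : ℝ) ^ m < |u x| := by exact_mod_cast hm1
      have hk2 : |u x| ≤ (2 : ℝ) ^ (m + 1) := by exact_mod_cast hm2
      refine le_add_left (le_trans ?_ (ENNReal.le_tsum m))
      rw [Set.indicator_of_mem (show x ∈ {x | (2 : ℝ) ^ m < |u x|} from hk1)]
      refine ENNReal.ofReal_le_ofReal ?_
      gcongr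
  calc ∫⁻ x in Ω, ENNReal.ofReal (|u x| ^ q)
      ≤ ∫⁻ x in Ω, (1 + ∑' k : ℕ, {x | 2 ^ k < |u x|}.indicator
          (fun _ => ENNReal.ofReal (((2 : ℝ) ^ (k + 1)) ^ q)) x) := lintegral_mono hpt
    _ = volume Ω + ∑' k : ℕ, ∫⁻ x in Ω, {x | 2 ^ k < |u x|}.indicator
          (fun _ => ENNReal.ofReal (((2 : ℝ) ^ (k + 1)) ^ q)) x := by
        rw [lintegral_add_left measurable_const, setLIntegral_one,
          lintegral_tsum fun k => (measurable_const.indicator (hmeas k)).aemeasurable]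
    _ ≤ volume Ω + ∑' k : ℕ, ENNReal.ofReal (2 ^ q * B * ρ ^ k) := by
        gcongr with k
        refine (setLIntegral_le_lintegral _ _).trans ?_
        rw [lintegral_indicator_const (hmeas k), ← ofReal_measureReal
          ((u.measure_superlevel_le (by positivity)).trans_lt h.measure_lt_top).ne,
          ← ENNReal.ofReal_mul (by positivity)]
        refine ENNReal.ofReal_le_ofReal ?_
        calc ((2 : ℝ) ^ (k + 1)) ^ q * volume.real {x | 2 ^ k < |u x|}
            ≤ ((2 : ℝ) ^ (k + 1)) ^ q * (B * ((2 : ℝ) ^ (-p)) ^ k) := by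
              gcongr
              exact hB u hu k
          _ = 2 ^ q * B * ρ ^ k := by
              have h1 : ((2 : ℝ) ^ (k + 1)) ^ q = 2 ^ q * (2 ^ q) ^ k := by
                simp only [← Real.rpow_natCast]
                rw [← Real.rpow_mul (by norm_num), ← Real.rpow_mul (by norm_num),
                  ← Real.rpow_add (by norm_num)]
                congr 1
                push_cast; ring
              rw [h1, hρ, sub_eq_add_neg, Real.rpow_add (by norm_num), mul_pow]
              ring
    _ = _ := by
        rw [ENNReal.ofReal_tsum_of_nonneg (fun k => by positivity) hsum]

end NonlocalSetting

/-! ### The Sobolev embedding and a local Poincaré inequality -/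

namespace NonlocalSetting

variable {n : ℕ} {s : ℝ} {Ω : Set (EuclideanSpace ℝ (Fin n))} {K : EuclideanSpace ℝ (Fin n) → ℝ}
  {h : NonlocalSetting s Ω K}

theorem two_lt_criticalExponent (h : NonlocalSetting s Ω K) : 2 < criticalExponent n s := by
  have h1 := h.s_pos
  have h2 := h.two_s_lt
  rw [criticalExponent, lt_div_iff₀ (by linarith)]
  linarith

theorem eLpNorm_ofReal_eq_lintegral {α : Type*} [MeasurableSpace α] (μ : Measure α) {q : ℝ}
    (hq0 : 0 < q) (w : α → ℝ) : eLpNorm w (ENNReal.ofReal q) μ =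
      (∫⁻ x, ENNReal.ofReal (|w x| ^ q) ∂μ) ^ (1 / q) := by
  rw [eLpNorm_eq_lintegral_rpow_enorm_toReal (by simpa using hq0) ENNReal.ofReal_ne_top,
    ENNReal.toReal_ofReal hq0.le]
  congr 1
  refine lintegral_congr fun x => ?_
  rw [← ENNReal.ofReal_rpow_of_nonneg (abs_nonneg _) hq0.le, ← Real.norm_eq_abs, ofReal_norm]

theorem exists_eLpNorm_le (h : NonlocalSetting s Ω K) {q : ℝ} (hq0 : 0 < q)
    (hq : q < criticalExponent n s) :
    ∃ C : ENNReal, C ≠ ⊤ ∧ ∀ u : h.X0, ‖u‖ ≤ 1 →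
      eLpNorm u (ENNReal.ofReal q) (volume.restrict Ω) ≤ C := by
  obtain ⟨C, hC, hCu⟩ := h.exists_lintegral_rpow_le hq0 hq
  refine ⟨C ^ (1 / q), ENNReal.rpow_ne_top_of_nonneg (by positivity) hC, fun u hu => ?_⟩
  rw [eLpNorm_ofReal_eq_lintegral _ hq0]
  exact ENNReal.rpow_le_rpow (hCu u hu) (by positivity)

theorem X0.exists_norm_le_one_eq_smul (u : h.X0) : ∃ v : h.X0, ‖v‖ ≤ 1 ∧ u = ‖u‖ • v := by
  rcases eq_or_ne u 0 with rfl | hu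
  · exact ⟨0, by simp, by simp⟩
  · have hu' : ‖u‖ ≠ 0 := norm_ne_zero_iff.2 hu
    refine ⟨‖u‖⁻¹ • u, ?_, ?_⟩
    · rw [norm_smul, norm_inv, norm_norm, inv_mul_cancel₀ hu']
    · rw [smul_smul, mul_inv_cancel₀ hu', one_smul]

theorem exists_eLpNorm_le_mul_norm (h : NonlocalSetting s Ω K) {q : ℝ} (hq0 : 0 < q)
    (hq : q < criticalExponent n s) :
    ∃ C : ℝ, 0 ≤ C ∧ ∀ u : h.X0,
      eLpNorm u (ENNReal.ofReal q) (volume.restrict Ω) ≤ ENNReal.ofReal (C * ‖u‖) := by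
  obtain ⟨C, hC, hCu⟩ := h.exists_eLpNorm_le hq0 hq
  refine ⟨C.toReal, ENNReal.toReal_nonneg, fun u => ?_⟩
  obtain ⟨v, hv, huv⟩ := u.exists_norm_le_one_eq_smul
  have h1 : (u : EuclideanSpace ℝ (Fin n) → ℝ) =ᵐ[volume.restrict Ω] ‖u‖ • ⇑v := by
    refine ae_restrict_of_ae ?_
    have := X0.coeFn_smul ‖u‖ v
    rw [← huv] at this
    exact this
  rw [eLpNorm_congr_ae h1, eLpNorm_const_smul, enorm_norm, ← ofReal_norm, mul_comm C.toReal,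
    ENNReal.ofReal_mul (norm_nonneg _), ENNReal.ofReal_toReal hC]
  gcongr
  exact hCu v hv

theorem X0.memLp_restrict (u : h.X0) {q : ℝ} (hq0 : 0 < q) (hq : q < criticalExponent n s) :
    MemLp u (ENNReal.ofReal q) (volume.restrict Ω) := by
  obtain ⟨C, -, hC⟩ := h.exists_eLpNorm_le_mul_norm hq0 hq
  exact ⟨u.measurable.aestronglyMeasurable, (hC u).trans_lt ENNReal.ofReal_lt_top⟩

/-- The Sobolev embedding of `X₀` into `L^q(Ω)` for subcritical `q`. -/
noncomputable def embedding (h : NonlocalSetting s Ω K) (q : ℝ) [Fact (1 ≤ ENNReal.ofReal q)]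
    (hq0 : 0 < q) (hq : q < criticalExponent n s) :
    h.X0 →L[ℝ] Lp ℝ (ENNReal.ofReal q) (volume.restrict Ω) :=
  LinearMap.mkContinuousOfExistsBound
    { toFun := fun u => (u.memLp_restrict hq0 hq).toLp
      map_add' := fun u v => by
        rw [← MemLp.toLp_add]
        exact MemLp.toLp_congr _ _ (ae_restrict_of_ae (X0.coeFn_add u v))
      map_smul' := fun c u => by
        rw [RingHom.id_apply, ← MemLp.toLp_const_smul]
        exact MemLp.toLp_congr _ _ (ae_restrict_of_ae (X0.coeFn_smul c u)) }
    (by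
      obtain ⟨C, hC0, hC⟩ := h.exists_eLpNorm_le_mul_norm hq0 hq
      refine ⟨C, fun u => ?_⟩
      change ‖(u.memLp_restrict hq0 hq).toLp‖ ≤ _
      rw [Lp.norm_toLp]
      exact ENNReal.toReal_le_of_le_ofReal (by positivity) (hC u))

theorem coeFn_embedding (h : NonlocalSetting s Ω K) {q : ℝ} [Fact (1 ≤ ENNReal.ofReal q)]
    (hq0 : 0 < q) (hq : q < criticalExponent n s) (u : h.X0) :
    h.embedding q hq0 hq u =ᵐ[volume.restrict Ω] u :=
  (u.memLp_restrict hq0 hq).coeFn_toLp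

theorem norm_embedding_rpow (h : NonlocalSetting s Ω K) {q : ℝ} [Fact (1 ≤ ENNReal.ofReal q)]
    (hq1 : 1 < q) (hq : q < criticalExponent n s) (u : h.X0) :
    ‖h.embedding q (by linarith) hq u‖ ^ q = ∫ x in Ω, |u x| ^ q := by
  rw [← IsGrowthPotential.norm_rpow_eq_integral hq1]
  refine integral_congr_ae ?_
  filter_upwards [h.coeFn_embedding (by linarith) hq u] with x hx
  rw [hx]

/-- Elements of `X₀` are square integrable on the whole space. -/
theorem X0.memLp_two (u : h.X0) : MemLp u 2 volume := by
  refine ((memLp_indicator_iff_restrict h.isOpen.measurableSet).2 u.memX.1).ae_eq ?_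
  filter_upwards [u.ae_eq_zero] with x hx
  by_cases hxΩ : x ∈ Ω
  · rw [Set.indicator_of_mem hxΩ]
  · rw [Set.indicator_of_notMem hxΩ, hx hxΩ]

theorem X0.integrable_sq (u : h.X0) : Integrable (fun x => u x ^ 2) volume :=
  u.memLp_two.integrable_sq

theorem X0.integrableOn (u : h.X0) : IntegrableOn u Ω volume := by
  have := h.isFiniteMeasure_restrict
  exact u.memX.1.integrable one_le_two

theorem X0.integrable_self (u : h.X0) : Integrable u volume := by
  refine ((integrable_indicator_iff h.isOpen.measurableSet).2 u.integrableOn).congr ?_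
  filter_upwards [u.ae_eq_zero] with x hx
  by_cases hxΩ : x ∈ Ω
  · rw [Set.indicator_of_mem hxΩ]
  · rw [Set.indicator_of_notMem hxΩ, hx hxΩ]

theorem stronglyMeasurable_setIntegral_ball {w : EuclideanSpace ℝ (Fin n) → ℝ}
    (hw : Measurable w) (r : ℝ) :
    StronglyMeasurable fun x => ∫ y in Metric.ball x r, w y := by
  have h1 : ∀ x, ∫ y in Metric.ball x r, w y =
      ∫ y, {p : EuclideanSpace ℝ (Fin n) × EuclideanSpace ℝ (Fin n) | dist p.2 p.1 < r}.indicator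
        (fun p => w p.2) (x, y) := fun x => by
    rw [← integral_indicator measurableSet_ball]
    rfl
  simp_rw [h1]
  refine StronglyMeasurable.integral_prod_right ?_
  exact (Measurable.indicator (hw.comp measurable_snd)
    (measurableSet_lt (measurable_snd.dist measurable_fst) measurable_const)).stronglyMeasurable

/-- A local Poincaré inequality: comparing `u x` with the averages of `u` over balls of radius `r`
controls `u` in `L²` up to an error of order `r ^ (2 s)`. -/
theorem exists_integral_sq_le (h : NonlocalSetting s Ω K) :
    ∃ C : ℝ, 0 < C ∧ ∀ (u : h.X0) (r : ℝ), 0 < r →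
      ∫ x in Ω, u x ^ 2 ≤ C * r ^ (2 * s) * ‖u‖ ^ 2 +
        4 / volume.real (Metric.ball (0 : EuclideanSpace ℝ (Fin n)) r) ^ 2 *
          ∫ x in Ω, (∫ y in Metric.ball x r, u y) ^ 2 := by
  obtain ⟨θ, hθ, hK⟩ := h.kernel_lower
  have hΩ := h.isFiniteMeasure_restrict
  set ω := volume.real (Metric.ball (0 : EuclideanSpace ℝ (Fin n)) 1) with hω
  have hω0 : 0 < ω := unitBall_pos
  refine ⟨2 / (ω * θ), by positivity, fun u r hr => ?_⟩
  have hvol : ∀ x, volume.real (Metric.ball x r) = r ^ n * ω := fun x => by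
    rw [Measure.real, volume_ball_eq x hr, ENNReal.toReal_ofReal (by positivity)]
  rw [hvol]
  set V := r ^ n * ω with hV
  have hV0 : 0 < V := by positivity
  set κ := θ * r ^ (-((n : ℝ) + 2 * s)) with hκ
  have hκ0 : 0 < κ := by positivity
  have hint := X0.integrable u u
  rw [Measure.volume_eq_prod] at hint
  set I : EuclideanSpace ℝ (Fin n) → ℝ := fun x => ∫ y, (u x - u y) * (u x - u y) * K (x - y)
    with hI
  set m : EuclideanSpace ℝ (Fin n) → ℝ := fun x => ∫ y in Metric.ball x r, u y with hm
  have hI0 : ∀ x, 0 ≤ I x := fun x => integral_nonneg fun y => h.mul_kernel_nonneg _ _ _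
  have hpt : ∀ᵐ x, u x ^ 2 ≤ 2 / (V * κ) * I x + 4 / V ^ 2 * m x ^ 2 := by
    filter_upwards [hint.prod_right_ae] with x hx
    have hfin : IsFiniteMeasure (volume.restrict (Metric.ball x r)) :=
      ⟨by simpa using measure_ball_lt_top⟩
    have e1 : Integrable (fun y => u y ^ 2) (volume.restrict (Metric.ball x r)) :=
      u.integrable_sq.restrict
    have e2 : Integrable (fun y => u y) (volume.restrict (Metric.ball x r)) :=
      u.integrable_self.restrict
    have e3 : Integrable (fun y => u x ^ 2 - 2 * u x * u y)
        (volume.restrict (Metric.ball x r)) := (integrable_const _).sub (e2.const_mul _)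
    have h1 : ∫ y in Metric.ball x r, (u x - u y) * (u x - u y) =
        V * u x ^ 2 - 2 * u x * m x + ∫ y in Metric.ball x r, u y ^ 2 := by
      have h2 : ∀ y, (u x - u y) * (u x - u y) = (u x ^ 2 - 2 * u x * u y) + u y ^ 2 :=
        fun y => by ring
      simp_rw [h2]
      rw [integral_add e3 e1,
        integral_sub (integrable_const _) (e2.const_mul _), integral_const_mul, integral_const,
        measureReal_restrict_apply_univ, hvol, smul_eq_mul]
    have h3 : (∫ y in Metric.ball x r, (u x - u y) * (u x - u y)) * κ ≤ I x := by
      rw [← integral_mul_const]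
      have h4 : ∫ y in Metric.ball x r, (u x - u y) * (u x - u y) * K (x - y) ≤ I x :=
        setIntegral_le_integral hx (ae_of_all _ fun y => h.mul_kernel_nonneg _ _ _)
      refine le_trans ?_ h4
      refine setIntegral_mono_on ?_ hx.integrableOn measurableSet_ball
        (fun y hy => h.le_mul_kernel hθ hK u hy)
      refine Integrable.mul_const ?_ _
      refine (e3.add e1).congr (ae_of_all _ fun y => ?_)
      simp only [Pi.add_apply]
      ring
    have h6 : 0 ≤ ∫ y in Metric.ball x r, u y ^ 2 := integral_nonneg fun y => sq_nonneg _
    have h7 : V * u x ^ 2 - 2 * u x * m x ≤ I x / κ := by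
      rw [le_div_iff₀ hκ0]
      refine le_trans ?_ h3
      rw [h1]
      gcongr
      linarith
    -- Young's inequality absorbs the mixed term `2 * u x * m x` into half of `V * u x ^ 2`.
    have h8 : 0 ≤ (V * u x - 2 * m x) ^ 2 := sq_nonneg _
    have h9 : 2 / (V * κ) * I x + 4 / V ^ 2 * m x ^ 2 =
        (2 * V * (I x / κ) + 4 * m x ^ 2) / V ^ 2 := by field_simp
    rw [h9, le_div_iff₀ (by positivity)]
    nlinarith
  have hIint : Integrable I := hint.integral_prod_left
  have hmbound : ∀ x, |m x| ≤ ∫ y, |u y| := fun x =>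
    (abs_integral_le_integral_abs).trans
      (setIntegral_le_integral u.integrable_self.abs (ae_of_all _ fun y => abs_nonneg _))
  have hmint : Integrable (fun x => m x ^ 2) (volume.restrict Ω) := by
    refine (integrable_const ((∫ y, |u y|) ^ 2)).mono'
      ((stronglyMeasurable_setIntegral_ball u.measurable r).pow 2).aestronglyMeasurable
      (ae_of_all _ fun x => ?_)
    rw [Real.norm_of_nonneg (sq_nonneg _), ← sq_abs]
    gcongr
    exact hmbound x
  have hcoef : 2 / (V * κ) = 2 / (ω * θ) * r ^ (2 * s) := by
    rw [hκ, hV, Real.rpow_neg hr.le, Real.rpow_add hr, Real.rpow_natCast]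
    field_simp
  calc ∫ x in Ω, u x ^ 2 ≤ ∫ x in Ω, (2 / (V * κ) * I x + 4 / V ^ 2 * m x ^ 2) :=
        integral_mono_ae u.integrable_sq.restrict
          ((hIint.restrict.const_mul _).add (hmint.const_mul _)) (ae_restrict_of_ae hpt)
    _ = 2 / (V * κ) * (∫ x in Ω, I x) + 4 / V ^ 2 * ∫ x in Ω, m x ^ 2 := by
        rw [integral_add (hIint.restrict.const_mul _) (hmint.const_mul _), integral_const_mul,
          integral_const_mul]
    _ ≤ 2 / (V * κ) * ‖u‖ ^ 2 + 4 / V ^ 2 * ∫ x in Ω, m x ^ 2 := by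
        gcongr
        rw [X0.norm_sq_eq, Measure.volume_eq_prod, integral_prod _ hint]
        exact setIntegral_le_integral hIint (ae_of_all _ hI0)
    _ = _ := by rw [hcoef]

end NonlocalSetting

/-! ### Compactness of the embedding and completeness of `X₀` -/

/-- Bounded sequences in a separable inner product space have weakly Cauchy subsequences. -/
theorem exists_subseq_tendsto_inner {V : Type*} [NormedAddCommGroup V] [InnerProductSpace ℝ V]
    [TopologicalSpace.SeparableSpace V] {u : ℕ → V} {R : ℝ} (hR : ∀ j, ‖u j‖ ≤ R) :
    ∃ k : ℕ → ℕ, StrictMono k ∧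
      ∀ v, ∃ l, Tendsto (fun j => inner ℝ (u (k j)) v) atTop (𝓝 l) := by
  have hmem : ∀ j, StrongDual.toWeakDual (innerSL ℝ (u j)) ∈
      WeakDual.toStrongDual ⁻¹' Metric.closedBall (0 : StrongDual ℝ V) R := fun j => by
    rw [Set.mem_preimage, mem_closedBall_zero_iff]
    change ‖innerSL ℝ (u j)‖ ≤ R
    rw [innerSL_apply_norm]
    exact hR j
  obtain ⟨T, -, k, hk, hT⟩ := WeakDual.isSeqCompact_closedBall ℝ V 0 R hmem
  exact ⟨k, hk, fun v => ⟨T v, ((WeakDual.eval_continuous v).tendsto T).comp hT⟩⟩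

namespace NonlocalSetting

variable {n : ℕ} {s : ℝ} {Ω : Set (EuclideanSpace ℝ (Fin n))} {K : EuclideanSpace ℝ (Fin n) → ℝ}
  {h : NonlocalSetting s Ω K}

theorem X0.setIntegral_inter (u : h.X0) {A : Set (EuclideanSpace ℝ (Fin n))}
    (hA : MeasurableSet A) : ∫ y in A ∩ Ω, u y = ∫ y in A, u y := by
  refine (setIntegral_eq_of_subset_of_ae_sdiff_eq_zero hA.nullMeasurableSet
    Set.inter_subset_left ?_).symm
  filter_upwards [u.ae_eq_zero] with x hx hxA
  exact hx fun hxΩ => hxA.2 ⟨hxA.1, hxΩ⟩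

theorem exists_integral_abs_le (h : NonlocalSetting s Ω K) :
    ∃ C : ℝ, 0 ≤ C ∧ ∀ u : h.X0, ∫ x in Ω, |u x| ≤ C * ‖u‖ := by
  obtain ⟨C, hC, hCu⟩ := h.exists_eLpNorm_le_mul_norm one_pos
    (one_lt_two.trans h.two_lt_criticalExponent)
  refine ⟨C, hC, fun u => ?_⟩
  have h1 := hCu u
  rw [ENNReal.ofReal_one, eLpNorm_one_eq_lintegral_enorm] at h1
  have h2 := integral_norm_eq_lintegral_enorm (μ := volume.restrict Ω)
    u.measurable.aestronglyMeasurable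
  simp only [Real.norm_eq_abs] at h2
  rw [h2]
  exact ENNReal.toReal_le_of_le_ofReal (by positivity) h1

/-- A bounded sequence in `X₀` has a subsequence whose integral over every ball converges. -/
theorem exists_subseq_tendsto_setIntegral_ball {u : ℕ → h.X0} {R : ℝ} (hR : ∀ j, ‖u j‖ ≤ R) :
    ∃ k : ℕ → ℕ, StrictMono k ∧ ∀ x r, ∃ l,
      Tendsto (fun j => ∫ y in Metric.ball x r, u (k j) y) atTop (𝓝 l) := by
  have hfin := h.isFiniteMeasure_restrict
  have htop : Fact ((2 : ENNReal) ≠ ⊤) := ⟨ENNReal.ofNat_ne_top⟩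
  obtain ⟨C, hC, hCu⟩ := h.exists_eLpNorm_le_mul_norm two_pos h.two_lt_criticalExponent
  simp only [ENNReal.ofReal_ofNat] at hCu
  obtain ⟨k, hk, hlim⟩ := exists_subseq_tendsto_inner (u := fun j => (u j).memX.1.toLp)
    (R := C * R) (fun j => by
      rw [Lp.norm_toLp]
      have hR0 : 0 ≤ R := (norm_nonneg _).trans (hR j)
      refine ENNReal.toReal_le_of_le_ofReal (by positivity) ((hCu (u j)).trans ?_)
      gcongr
      exact hR j)
  refine ⟨k, hk, fun x r => ?_⟩
  obtain ⟨l, hl⟩ := hlim (indicatorConstLp 2 (measurableSet_ball (x := x) (ε := r))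
    (measure_ne_top _ _) (1 : ℝ))
  refine ⟨l, hl.congr fun j => ?_⟩
  rw [real_inner_comm, L2.inner_indicatorConstLp_one, Measure.restrict_restrict measurableSet_ball,
    ← X0.setIntegral_inter _ measurableSet_ball]
  refine integral_congr_ae (ae_restrict_of_ae_restrict_of_subset Set.inter_subset_right ?_)
  exact (u (k j)).memX.1.coeFn_toLp

theorem X0.coeFn_sub (u v : h.X0) : ∀ᵐ x, (u - v) x = u x - v x := AEEqFun.coeFn_sub u.1 v.1

/-- Compactness of the embedding of `X₀` in `L²(Ω)`, as a Cauchy property of a subsequence. -/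
theorem exists_subseq_tendsto_integral_sq {u : ℕ → h.X0} {R : ℝ} (hR : ∀ j, ‖u j‖ ≤ R) :
    ∃ k : ℕ → ℕ, StrictMono k ∧ Tendsto
      (fun p : ℕ × ℕ => ∫ x in Ω, (u (k p.1) - u (k p.2)) x ^ 2) atTop (𝓝 0) := by
  have hfin := h.isFiniteMeasure_restrict
  obtain ⟨k, hk, hlim⟩ := exists_subseq_tendsto_setIntegral_ball hR
  refine ⟨k, hk, ?_⟩
  set w : ℕ × ℕ → h.X0 := fun p => u (k p.1) - u (k p.2) with hw
  have hR0 : 0 ≤ R := (norm_nonneg _).trans (hR 0)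
  have hwR : ∀ p, ‖w p‖ ≤ 2 * R := fun p =>
    (norm_sub_le _ _).trans (by linarith [hR (k p.1), hR (k p.2)])
  obtain ⟨C, hC, hpoincare⟩ := h.exists_integral_sq_le
  obtain ⟨C₁, hC₁, habs⟩ := h.exists_integral_abs_le
  have hbound : ∀ p x r, |∫ y in Metric.ball x r, w p y| ≤ C₁ * (2 * R) := fun p x r => by
    rw [← X0.setIntegral_inter _ measurableSet_ball]
    refine abs_integral_le_integral_abs.trans ((setIntegral_mono_set
      (w p).integrableOn.abs (ae_of_all _ fun y => abs_nonneg _)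
      (ae_of_all _ Set.inter_subset_right)).trans ((habs _).trans ?_))
    gcongr
    exact hwR p
  have hconv : ∀ x r, Tendsto (fun p => ∫ y in Metric.ball x r, w p y) atTop (𝓝 0) := by
    intro x r
    obtain ⟨l, hl⟩ := hlim x r
    have h1 := (hl.comp (tendsto_fst.mono_left prod_atTop_atTop_eq.ge)).sub
      (hl.comp (tendsto_snd.mono_left prod_atTop_atTop_eq.ge))
    rw [sub_self] at h1
    refine h1.congr fun p => ?_
    dsimp only [Function.comp_apply]
    rw [← integral_sub (u _).integrable_self.restrict (u _).integrable_self.restrict]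
    refine integral_congr_ae (ae_restrict_of_ae ?_)
    filter_upwards [X0.coeFn_sub (u (k p.1)) (u (k p.2))] with y hy using hy.symm
  have hmean : ∀ r, Tendsto (fun p => ∫ x in Ω, (∫ y in Metric.ball x r, w p y) ^ 2) atTop
      (𝓝 0) := by
    intro r
    have h1 : Tendsto (fun p => ∫ x in Ω, (∫ y in Metric.ball x r, w p y) ^ 2) atTop
        (𝓝 (∫ _ in Ω, (0 : ℝ))) := by
      refine tendsto_integral_filter_of_dominated_convergence (fun _ => (C₁ * (2 * R)) ^ 2) ?_ ?_
        (integrable_const _) ?_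
      · exact Eventually.of_forall fun p =>
          ((stronglyMeasurable_setIntegral_ball (w p).measurable r).pow 2).aestronglyMeasurable
      · refine Eventually.of_forall fun p => ae_of_all _ fun x => ?_
        rw [Real.norm_of_nonneg (sq_nonneg _), ← sq_abs]
        gcongr
        exact hbound p x r
      · refine ae_of_all _ fun x => ?_
        have := (hconv x r).pow 2
        rwa [zero_pow two_ne_zero] at this
    rwa [integral_zero] at h1
  have hs := h.s_pos
  rw [Metric.tendsto_nhds]
  intro ε hε
  -- The error term of the Poincaré inequality is uniformly small for small radii.
  have hr : Tendsto (fun r : ℝ => C * r ^ (2 * s) * (2 * R) ^ 2) (𝓝[>] 0) (𝓝 0) := by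
    have h1 : Tendsto (fun r : ℝ => C * r ^ (2 * s) * (2 * R) ^ 2) (𝓝 0)
        (𝓝 (C * 0 ^ (2 * s) * (2 * R) ^ 2)) :=
      (((Real.continuousAt_rpow_const 0 (2 * s) (Or.inr (by positivity))).tendsto).const_mul
        C).mul_const _
    rw [Real.zero_rpow (by positivity), mul_zero, zero_mul] at h1
    exact h1.mono_left nhdsWithin_le_nhds
  obtain ⟨r, hrε, hr0⟩ := ((hr.eventually (gt_mem_nhds (half_pos hε))).and
    self_mem_nhdsWithin).exists
  have hr0' : 0 < r := hr0
  have h2 := (hmean r).const_mul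
    (4 / volume.real (Metric.ball (0 : EuclideanSpace ℝ (Fin n)) r) ^ 2)
  rw [mul_zero] at h2
  filter_upwards [h2.eventually (gt_mem_nhds (half_pos hε))] with p hp
  rw [Real.dist_eq, sub_zero, abs_of_nonneg (integral_nonneg fun x => sq_nonneg _)]
  have h3 := hpoincare (w p) r hr0'
  have h4 : C * r ^ (2 * s) * ‖w p‖ ^ 2 ≤ C * r ^ (2 * s) * (2 * R) ^ 2 := by
    gcongr
    exact hwR p
  linarith

theorem rpow_le_add_of_between {q p L t : ℝ} (hq : 2 ≤ q) (hqp : q ≤ p) (hL : 0 < L)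
    (ht : 0 ≤ t) : t ^ q ≤ L ^ (q - p) * t ^ p + L ^ (q - 2) * t ^ 2 := by
  rcases le_total t L with htL | htL
  · rcases ht.eq_or_lt with rfl | ht
    · rw [Real.zero_rpow (by linarith), Real.zero_rpow (by linarith)]
      simp
    · have h1 : t ^ q = t ^ (q - 2) * t ^ 2 := by
        rw [← Real.rpow_two, ← Real.rpow_add ht, sub_add_cancel]
      have h2 : t ^ (q - 2) ≤ L ^ (q - 2) := by gcongr
      have h3 : 0 ≤ L ^ (q - p) * t ^ p := by positivity
      rw [h1]
      nlinarith [sq_nonneg t]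
  · have ht' : 0 < t := hL.trans_le htL
    have h1 : t ^ q = t ^ (q - p) * t ^ p := by
      rw [← Real.rpow_add ht', sub_add_cancel]
    have h2 : t ^ (q - p) ≤ L ^ (q - p) := Real.rpow_le_rpow_of_nonpos hL htL (by linarith)
    have h3 : 0 ≤ L ^ (q - 2) * t ^ 2 := by positivity
    have h4 : 0 ≤ t ^ p := by positivity
    rw [h1]
    nlinarith

/-- Compactness of the embedding of `X₀` in `L^q(Ω)`: interpolate between compactness in `L²(Ω)`
and boundedness in `L^p(Ω)` for some subcritical `p > q`. -/
theorem exists_subseq_tendsto_embedding {q : ℝ} [Fact (1 ≤ ENNReal.ofReal q)] (hq2 : 2 ≤ q)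
    (hq0 : 0 < q) (hq : q < criticalExponent n s) (u : ℕ → h.X0) (hu : ∃ R, ∀ j, ‖u j‖ ≤ R) :
    ∃ k : ℕ → ℕ, StrictMono k ∧
      ∃ v, Tendsto (fun j => h.embedding q hq0 hq (u (k j))) atTop (𝓝 v) := by
  obtain ⟨R, hR⟩ := hu
  obtain ⟨k, hk, hlim⟩ := exists_subseq_tendsto_integral_sq hR
  refine ⟨k, hk, cauchySeq_tendsto_of_complete ?_⟩
  set w : ℕ × ℕ → h.X0 := fun p => u (k p.1) - u (k p.2) with hw
  have hR0 : 0 ≤ R := (norm_nonneg _).trans (hR 0)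
  have hwR : ∀ p, ‖w p‖ ≤ 2 * R := fun p =>
    (norm_sub_le _ _).trans (by linarith [hR (k p.1), hR (k p.2)])
  obtain ⟨p, hqp, hp⟩ := exists_between hq
  have hp1 : Fact (1 ≤ ENNReal.ofReal p) := ⟨by rw [ENNReal.one_le_ofReal]; linarith⟩
  set M := (‖h.embedding p (by linarith) hp‖ * (2 * R)) ^ p with hM
  have hM0 : 0 ≤ M := by positivity
  have hpM : ∀ i, ∫ x in Ω, |w i x| ^ p ≤ M := fun i => by
    rw [← h.norm_embedding_rpow (by linarith) hp]
    refine Real.rpow_le_rpow (norm_nonneg _)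
      (((h.embedding p (by linarith) hp).le_opNorm _).trans ?_) (by linarith)
    gcongr
    exact hwR i
  have key : Tendsto (fun i => ∫ x in Ω, |w i x| ^ q) atTop (𝓝 0) := by
    rw [Metric.tendsto_nhds]
    intro ε hε
    have hL : Tendsto (fun L : ℝ => L ^ (-(p - q)) * M) atTop (𝓝 0) := by
      simpa using (tendsto_rpow_neg_atTop (by linarith : 0 < p - q)).mul_const M
    -- `L` splits off the large values, controlled by the `L^p` bound.
    obtain ⟨L, hLε, hL0⟩ := ((hL.eventually (gt_mem_nhds (half_pos hε))).and
      (eventually_gt_atTop 0)).exists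
    have h1 := hlim.const_mul (L ^ (q - 2))
    rw [mul_zero] at h1
    filter_upwards [h1.eventually (gt_mem_nhds (half_pos hε))] with i hi
    rw [Real.dist_eq, sub_zero, abs_of_nonneg (integral_nonneg fun x => by positivity)]
    have e1 : Integrable (fun x => |w i x| ^ p) (volume.restrict Ω) :=
      IsGrowthPotential.integrable_abs_rpow (by linarith) ((w i).memLp_restrict (by linarith) hp)
    have e2 : Integrable (fun x => w i x ^ 2) (volume.restrict Ω) := (w i).integrable_sq.restrict
    have h2 : ∫ x in Ω, |w i x| ^ q ≤
        L ^ (q - p) * (∫ x in Ω, |w i x| ^ p) + L ^ (q - 2) * ∫ x in Ω, w i x ^ 2 := by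
      rw [← integral_const_mul, ← integral_const_mul,
        ← integral_add (e1.const_mul _) (e2.const_mul _)]
      refine integral_mono_of_nonneg (ae_of_all _ fun x => by positivity)
        ((e1.const_mul _).add (e2.const_mul _)) (ae_of_all _ fun x => ?_)
      have := rpow_le_add_of_between hq2 hqp.le hL0 (abs_nonneg (w i x))
      rwa [sq_abs] at this
    have h3 : L ^ (q - p) * (∫ x in Ω, |w i x| ^ p) ≤ L ^ (-(p - q)) * M := by
      rw [neg_sub]
      gcongr
      exact hpM i
    linarith
  rw [cauchySeq_iff_tendsto_dist_atTop_0]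
  have h1 := key.rpow_const (p := 1 / q) (Or.inr (by positivity))
  rw [Real.zero_rpow (by positivity)] at h1
  refine h1.congr fun i => ?_
  rw [← h.norm_embedding_rpow (by linarith) hq, ← Real.rpow_mul (norm_nonneg _),
    mul_one_div_cancel hq0.ne', Real.rpow_one, dist_eq_norm, ← map_sub]

/-- The isometry `u ↦ (u x - u y) √(K (x - y))` of `X₀` into `L²(ℝⁿ × ℝⁿ)`. -/
noncomputable def X0.toL2 (u : h.X0) :
    Lp ℝ 2 (volume : Measure (EuclideanSpace ℝ (Fin n) × EuclideanSpace ℝ (Fin n))) :=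
  u.memLp.toLp

theorem X0.dist_toL2 (u v : h.X0) : dist u.toL2 v.toL2 = dist u v := by
  have h1 : dist u.toL2 v.toL2 ^ 2 = dist u v ^ 2 := by
    rw [dist_eq_norm, dist_eq_norm, X0.norm_sq_eq, ← real_inner_self_eq_norm_sq, L2.inner_def]
    refine integral_congr_ae ?_
    filter_upwards [Lp.coeFn_sub u.toL2 v.toL2, u.memLp.coeFn_toLp, v.memLp.coeFn_toLp,
      ae_fst_snd (X0.coeFn_sub u v)] with p h1 h2 h3 h4
    rw [h1, Pi.sub_apply, X0.toL2, X0.toL2, h2, h3, h4.1, h4.2]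
    by_cases hp : p.1 = p.2
    · simp [hp]
    · have hK := Real.mul_self_sqrt (h.kernel_pos _ (sub_ne_zero.2 hp)).le
      simp only [RCLike.inner_apply, conj_trivial]
      linear_combination (u p.1 - v p.1 - (u p.2 - v p.2)) * (u p.1 - v p.1 - (u p.2 - v p.2)) * hK
  exact (pow_left_inj₀ dist_nonneg dist_nonneg two_ne_zero).1 h1

/-- A limit of a Cauchy sequence in `L²(Ω)`, extended by zero, has the limit of the weighted
differences as its own weighted difference, by almost everywhere convergence along a
subsequence. -/
theorem completeSpace_X0 (h : NonlocalSetting s Ω K) : CompleteSpace h.X0 := by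
  refine Metric.complete_of_cauchySeq_tendsto fun u hu => ?_
  have h2 : Fact (1 ≤ ENNReal.ofReal 2) := ⟨by rw [ENNReal.one_le_ofReal]; norm_num⟩
  have hcrit := h.two_lt_criticalExponent
  -- Convergence in `L²(Ω)`, hence almost everywhere along a subsequence
  obtain ⟨v, hv⟩ := cauchySeq_tendsto_of_complete
    ((h.embedding 2 two_pos hcrit).uniformContinuous.comp_cauchySeq hu)
  obtain ⟨k, hk, hkv⟩ := IsGrowthPotential.exists_subseq_ae_tendsto hv
  -- Convergence of the weighted differences in `L²(ℝⁿ × ℝⁿ)`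
  obtain ⟨W, hW⟩ := cauchySeq_tendsto_of_complete (u := fun j => (u j).toL2) (by
    rw [Metric.cauchySeq_iff] at hu ⊢
    simpa only [X0.dist_toL2] using hu)
  obtain ⟨m, hm, hmW⟩ := (tendstoInMeasure_of_tendsto_Lp
    (hW.comp hk.tendsto_atTop)).exists_seq_tendsto_ae
  have hkv' : ∀ᵐ x, Tendsto (fun j => u (k (m j)) x) atTop (𝓝 (Ω.indicator v x)) := by
    have h3 : ∀ᵐ x, x ∈ Ω → Tendsto (fun j => u (k (m j)) x) atTop (𝓝 (v x)) := by
      rw [← ae_restrict_iff' h.isOpen.measurableSet]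
      filter_upwards [hkv, ae_all_iff.2 fun j => h.coeFn_embedding two_pos hcrit (u j)]
        with x hx hux
      refine (hx.comp hm.tendsto_atTop).congr fun j => ?_
      exact hux _
    filter_upwards [h3, ae_all_iff.2 fun j => (u j).ae_eq_zero] with x hx h0
    by_cases hxΩ : x ∈ Ω
    · rw [Set.indicator_of_mem hxΩ]
      exact hx hxΩ
    · rw [Set.indicator_of_notMem hxΩ]
      exact tendsto_const_nhds.congr fun j => (h0 _ hxΩ).symm
  have hvm : AEStronglyMeasurable (Ω.indicator v) volume :=
    (aestronglyMeasurable_indicator_iff h.isOpen.measurableSet).2 (Lp.aestronglyMeasurable v)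
  set g := AEEqFun.mk (Ω.indicator v) hvm with hg
  have hgv : ∀ᵐ x, g x = Ω.indicator v x := AEEqFun.coeFn_mk _ hvm
  have hgW : (fun p : EuclideanSpace ℝ (Fin n) × EuclideanSpace ℝ (Fin n) =>
      (g p.1 - g p.2) * √(K (p.1 - p.2))) =ᵐ[volume] W := by
    filter_upwards [ae_fst_snd hgv, ae_fst_snd hkv', hmW,
      ae_all_iff.2 fun j => (u j).memLp.coeFn_toLp] with p h3 h4 h5 h6
    refine tendsto_nhds_unique ?_ h5
    rw [h3.1, h3.2]
    refine ((h4.1.sub h4.2).mul_const _).congr fun j => ?_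
    exact (h6 _).symm
  have hgmem : g ∈ X0Submodule Ω K := by
    refine ⟨⟨?_, ((Lp.memLp W).ae_eq hgW.symm).restrict _⟩, ?_⟩
    · have h3 : ∀ p, p = ENNReal.ofReal 2 → MemLp v p (volume.restrict Ω) := by
        rintro _ rfl
        exact Lp.memLp v
      refine (h3 2 (ENNReal.ofReal_ofNat 2).symm).ae_eq ?_
      refine (ae_restrict_iff' h.isOpen.measurableSet).2 ?_
      filter_upwards [hgv] with x hx hxΩ
      rw [hx, Set.indicator_of_mem hxΩ]
    · filter_upwards [hgv] with x hx hxΩ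
      rw [hx, Set.indicator_of_notMem hxΩ]
  let U : h.X0 := ⟨g, hgmem⟩
  have hUW : U.toL2 = W := Lp.ext (U.memLp.coeFn_toLp.trans hgW)
  refine ⟨U, ?_⟩
  rw [tendsto_iff_dist_tendsto_zero] at hW ⊢
  rw [← hUW] at hW
  simpa only [X0.dist_toL2] using hW

end NonlocalSetting

/-! ### The energy functional -/

theorem jeanjeanFun_neg {n : ℕ} {f : EuclideanSpace ℝ (Fin n) → ℝ → ℝ}
    {x : EuclideanSpace ℝ (Fin n)} (hodd : ∀ t, f x (-t) = -f x t) (t : ℝ) :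
    jeanjeanFun f x (-t) = jeanjeanFun f x t := by
  have h1 : primitive f x (-t) = primitive f x t := by
    have h2 := intervalIntegral.integral_comp_neg (a := 0) (b := t) (f x)
    simp only [hodd, intervalIntegral.integral_neg, neg_zero] at h2
    rw [intervalIntegral.integral_symm (a := 0) (b := -t)] at h2
    exact (neg_injective h2).symm
  rw [jeanjeanFun, jeanjeanFun, h1, hodd]
  ring

/-- By oddness of `f`, the quasi-monotonicity for positive arguments holds along every ray. -/
theorem jeanjeanFun_smul_le {n : ℕ} {f : EuclideanSpace ℝ (Fin n) → ℝ → ℝ}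
    {x : EuclideanSpace ℝ (Fin n)} (hodd : ∀ t, f x (-t) = -f x t) {γ : ℝ}
    (hγ : ∀ t t' : ℝ, 0 < t' → t' ≤ t → jeanjeanFun f x t' ≤ γ * jeanjeanFun f x t)
    (t : ℝ) {τ : ℝ} (hτ0 : 0 < τ) (hτ1 : τ ≤ 1) :
    jeanjeanFun f x (τ * t) ≤ γ * jeanjeanFun f x t := by
  rcases lt_trichotomy t 0 with ht | rfl | ht
  · rw [← jeanjeanFun_neg hodd, ← jeanjeanFun_neg hodd t, ← mul_neg]
    exact hγ _ _ (mul_pos hτ0 (neg_pos.2 ht)) (mul_le_of_le_one_left (neg_pos.2 ht).le hτ1)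
  · simp [jeanjeanFun, primitive]
  · exact hγ _ _ (mul_pos hτ0 ht) (mul_le_of_le_one_left ht.le hτ1)

theorem IsGrowthPotential.of_continuous {n : ℕ} {μ : Measure (EuclideanSpace ℝ (Fin n))} {q : ℝ}
    (hq : 2 ≤ q) {f : EuclideanSpace ℝ (Fin n) → ℝ → ℝ} (hf : Continuous (Function.uncurry f))
    {a₁ a₂ : ℝ} (ha₁ : 0 ≤ a₁) (ha₂ : 0 ≤ a₂)
    (hgrowth : ∀ᵐ x ∂μ, ∀ t : ℝ, |f x t| ≤ a₁ + a₂ * |t| ^ (q - 1)) (lam : ℝ) :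
    IsGrowthPotential μ q (fun x t => lam * t + f x t)
      (fun x t => lam / 2 * t ^ 2 + primitive f x t) where
  one_lt := by linarith
  measurable_deriv := by
    have : Continuous fun p : EuclideanSpace ℝ (Fin n) × ℝ => lam * p.2 + f p.1 p.2 :=
      (continuous_const.mul continuous_snd).add hf
    exact this.measurable
  measurable := by
    have h1 : Continuous fun p : EuclideanSpace ℝ (Fin n) × ℝ => primitive f p.1 p.2 :=
      intervalIntegral.continuous_parametric_intervalIntegral_of_continuous
        (f := fun (p : EuclideanSpace ℝ (Fin n) × ℝ) τ => f p.1 τ)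
        (hf.comp ((continuous_fst.comp continuous_fst).prodMk continuous_snd)) continuous_snd
    have : Continuous fun p : EuclideanSpace ℝ (Fin n) × ℝ =>
        lam / 2 * p.2 ^ 2 + primitive f p.1 p.2 :=
      (continuous_const.mul (continuous_snd.pow 2)).add h1
    exact this.measurable
  continuous_deriv x := (continuous_const.mul continuous_id).add
    (hf.comp (continuous_const.prodMk continuous_id))
  hasDerivAt x t := by
    have hfx : Continuous (f x) := hf.comp (continuous_const.prodMk continuous_id)
    have h1 : HasDerivAt (fun t => lam / 2 * t ^ 2) (lam * t) t := by
      refine ((hasDerivAt_pow 2 t).const_mul (lam / 2)).congr_deriv ?_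
      push_cast
      ring
    exact h1.add (hfx.integral_hasStrictDerivAt 0 t).hasDerivAt
  zero x := by simp [primitive]
  growth := by
    refine ⟨|lam| + a₁ + a₂, by positivity, hgrowth.mono fun x hx t => ?_⟩
    have h1 : |t| ≤ 1 + |t| ^ (q - 1) := by
      rcases le_total |t| 1 with h | h
      · have : 0 ≤ |t| ^ (q - 1) := by positivity
        linarith
      · have := Real.self_le_rpow_of_one_le h (by linarith : 1 ≤ q - 1)
        linarith
    have h2 := abs_add_le (lam * t) (f x t)
    have h3 := mul_le_mul_of_nonneg_left h1 (abs_nonneg lam)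
    have h4 : 0 ≤ |t| ^ (q - 1) := by positivity
    have h5 := mul_nonneg ha₁ h4
    rw [abs_mul] at h2
    linarith [hx t]

/-- A superquadratic bound for large `|t|` extends to all `t` at the cost of a constant. -/
theorem exists_sub_le_of_superquadratic {α : Type*} [MeasurableSpace α] {μ : Measure α} {q : ℝ}
    {g G : α → ℝ → ℝ} (hG : IsGrowthPotential μ q g G) {M : ℝ}
    (hM : ∃ T : ℝ, 0 < T ∧ ∀ᵐ x ∂μ, ∀ t, T ≤ |t| → M * t ^ 2 ≤ G x t) :
    ∃ D : ℝ, ∀ᵐ x ∂μ, ∀ t, M * t ^ 2 - D ≤ G x t := by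
  obtain ⟨T, hT, h⟩ := hM
  obtain ⟨C, hC, hg⟩ := hG.growth
  have hq := hG.one_lt
  refine ⟨|M| * T ^ 2 + 2 * C * (1 + T ^ q), ?_⟩
  filter_upwards [h, hg] with x hx hgx t
  have h0 : 0 ≤ |M| * T ^ 2 + 2 * C * (1 + T ^ q) := by positivity
  rcases le_or_gt T |t| with ht | ht
  · linarith [hx t ht]
  · have h1 := hG.abs_potential_le hC hgx t
    have h2 : 2 * C * (1 + |t| ^ q) ≤ 2 * C * (1 + T ^ q) := by gcongr
    have h3 : M * t ^ 2 ≤ |M| * T ^ 2 := by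
      rw [← sq_abs t]
      gcongr
      exact le_abs_self M
    linarith [neg_abs_le (G x t)]

/-- The energy as an abstract action, with the term in `lam` moved into the potential. -/
theorem energy_eq_action {n : ℕ} {s : ℝ} {Ω : Set (EuclideanSpace ℝ (Fin n))}
    {K : EuclideanSpace ℝ (Fin n) → ℝ} (h : NonlocalSetting s Ω K)
    {f f' : EuclideanSpace ℝ (Fin n) → ℝ → ℝ} (hff' : ∀ x ∈ Ω, f x = f' x) {q lam : ℝ}
    [Fact (1 ≤ ENNReal.ofReal q)] (hq0 : 0 < q)
    (hq : q < NonlocalSetting.criticalExponent n s) {g : EuclideanSpace ℝ (Fin n) → ℝ → ℝ}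
    (hG : IsGrowthPotential (volume.restrict Ω) q g
      (fun x t => lam / 2 * t ^ 2 + primitive f' x t)) :
    energy h f lam = IsGrowthPotential.action (h.embedding q hq0 hq)
      (fun x t => lam / 2 * t ^ 2 + primitive f' x t) := by
  have hfin := h.isFiniteMeasure_restrict
  funext u
  have h1 : ‖u‖ ^ 2 = ∫ p : EuclideanSpace ℝ (Fin n) × EuclideanSpace ℝ (Fin n),
      |u p.1 - u p.2| ^ 2 * K (p.1 - p.2) := by
    rw [NonlocalSetting.X0.norm_sq_eq]
    simp only [sq_abs]
    simp only [sq]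
  have h2 : ∫ x in Ω, (lam / 2 * h.embedding q hq0 hq u x ^ 2 +
      primitive f' x (h.embedding q hq0 hq u x)) =
      ∫ x in Ω, (lam / 2 * u x ^ 2 + primitive f' x (u x)) := by
    refine integral_congr_ae ?_
    filter_upwards [h.coeFn_embedding hq0 hq u] with x hx
    rw [hx]
  have h3 : Integrable (fun x => lam / 2 * u x ^ 2) (volume.restrict Ω) :=
    u.integrable_sq.restrict.const_mul _
  have h4 : Integrable (fun x => primitive f' x (u x)) (volume.restrict Ω) := by
    refine ((hG.integrable_comp (u.memLp_restrict hq0 hq)).sub h3).congr (ae_of_all _ fun x => ?_)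
    simp
  have h5 : ∫ x in Ω, primitive f x (u x) = ∫ x in Ω, primitive f' x (u x) := by
    refine setIntegral_congr_fun h.isOpen.measurableSet fun x hx => ?_
    simp only [primitive, hff' x hx]
  rw [IsGrowthPotential.action, h2, integral_add h3 h4, integral_const_mul, energy, h1, h5]
  simp only [sq_abs]
  ring

theorem proposition4p1 {n : ℕ} {s : ℝ} {Ω : Set (EuclideanSpace ℝ (Fin n))}
    {K : EuclideanSpace ℝ (Fin n) → ℝ} (h : NonlocalSetting s Ω K)
    (f : EuclideanSpace ℝ (Fin n) → ℝ → ℝ)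
    (hf_cont : ContinuousOn (Function.uncurry f) (closure Ω ×ˢ Set.univ))
    (hf_growth : ∃ a₁ a₂ q : ℝ, 0 < a₁ ∧ 0 < a₂ ∧ 2 < q ∧ q < 2 * n / (n - 2 * s) ∧
      ∀ x ∈ Ω, ∀ t : ℝ, |f x t| ≤ a₁ + a₂ * |t| ^ (q - 1))
    (hf_odd : ∀ x ∈ Ω, ∀ t : ℝ, f x (-t) = -f x t)
    (hF_superquadratic : ∀ M : ℝ, ∃ T : ℝ, 0 < T ∧ ∀ x ∈ closure Ω, ∀ t : ℝ, T ≤ |t| →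
      M ≤ primitive f x t / |t| ^ 2)
    (hf_jeanjean : ∃ γ : ℝ, 1 ≤ γ ∧ ∀ x ∈ Ω, ∀ t t' : ℝ, 0 < t' → t' ≤ t →
      jeanjeanFun f x t' ≤ γ * jeanjeanFun f x t)
    (lam : ℝ) :
    Differentiable ℝ (energy h f lam) ∧ ∀ c : ℝ, CeramiCondition (energy h f lam) c := by
  obtain ⟨a₁, a₂, q, ha₁, ha₂, hq2, hq, hgrowth⟩ := hf_growth
  obtain ⟨γ, -, hγ⟩ := hf_jeanjean
  have hfin := h.isFiniteMeasure_restrict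
  have hcomplete := h.completeSpace_X0
  have hfact : Fact (1 ≤ ENNReal.ofReal q) := ⟨by rw [ENNReal.one_le_ofReal]; linarith⟩
  have hq0 : 0 < q := by linarith
  have hΩ : ∀ᵐ x ∂(volume.restrict Ω), x ∈ Ω := ae_restrict_mem h.isOpen.measurableSet
  -- Only the values of `f` over `Ω` enter the energy, so `f` may be taken continuous everywhere.
  obtain ⟨e, he⟩ := ContinuousMap.exists_restrict_eq
    (isClosed_closure.prod isClosed_univ : IsClosed (closure Ω ×ˢ (Set.univ : Set ℝ)))
    ⟨_, hf_cont.domRestrict⟩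
  set f' : EuclideanSpace ℝ (Fin n) → ℝ → ℝ := fun x t => e (x, t) with hf'
  have hff' : ∀ x ∈ Ω, f x = f' x := fun x hx => funext fun t => by
    have := DFunLike.congr_fun he ⟨(x, t), subset_closure hx, Set.mem_univ t⟩
    exact this.symm
  have hprim : ∀ x ∈ Ω, primitive f' x = primitive f x := fun x hx => funext fun t => by
    simp only [primitive, hff' x hx]
  have hG := IsGrowthPotential.of_continuous (μ := volume.restrict Ω) (f := f') hq2.le
    (show Continuous (Function.uncurry f') from e.continuous) ha₁.le ha₂.le
    (hΩ.mono fun x hx t => by rw [← hff' x hx]; exact hgrowth x hx t) lam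
  rw [energy_eq_action h hff' hq0 hq hG]
  refine ⟨fun u => (hG.hasFDerivAt_action u).differentiableAt, fun c =>
    hG.ceramiCondition_action hq2.le
      (NonlocalSetting.exists_subseq_tendsto_embedding hq2.le hq0 hq) (fun M => ?_) (γ := γ) ?_ c⟩
  · obtain ⟨T, hT, hTF⟩ := hF_superquadratic (M - lam / 2)
    refine exists_sub_le_of_superquadratic hG ⟨T, hT, hΩ.mono fun x hx t ht => ?_⟩
    have h1 := hTF x (subset_closure hx) t ht
    have h2 : 0 < |t| := hT.trans_le ht
    rw [le_div_iff₀ (by positivity), sq_abs] at h1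
    rw [hprim x hx]
    linarith
  · filter_upwards [hΩ] with x hx t τ hτ0 hτ1
    have h1 := jeanjeanFun_smul_le (hf_odd x hx) (hγ x hx) t hτ0 hτ1
    simp only [jeanjeanFun] at h1
    rw [hprim x hx, ← hff' x hx]
    linear_combination h1
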